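/- **Setting.** Let $\widehat\rho$ be a symmetric tensor C*-category generated by an object $\rho$: its objects are the tensor powers $\rho^r$, $r\in\mathbb N$, with $\iota=\rho^0$; its arrow spaces $(\rho^r,\rho^s)$ are complex Banach spaces, with composition, identities, a C*-involution, a strict associative and unital tensor product $\otimes$, and a unitary symmetry $\varepsilon(\rho^r,\rho^s)\in(\rho^{r+s},\rho^{r+s})$. Then $(\iota,\iota)$ is a commutative unital C*-algebra; let $X$ be its spectrum, a compact Hausdorff space, so that $(\iota,\iota)=C(X)$. For $W\subseteq X$ closed, $\widehat\rho_W$ denotes the category with arrows $(\rho^r,\rho^s)$ modulo the closed span of the arrows $f\otimes t$, $f\in C(X)$, $f|_W=0$. For a symmetric tensor C*-category $\mathcal T$, $W\mathcal T$ is the category with the same objects and with arrows the continuous maps from $W$ into the arrow spaces of $\mathcal T$. *Special category.* $\widehat\rho$ is a *special category* with fibre $\widehat\rho_\bullet$ (a symmetric tensor C*-category generated by $\rho_\bullet$ with $(\iota_\bullet,\iota_\bullet)=\mathbb C$) if every $x\in X$ has a closed neighbourhood $W$ with a local chart $\widehat\rho_W\to W\widehat\rho_\bullet$, i.e. a $C(W)$-linear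 isomorphism mapping $\rho$ to $\rho_\bullet$ and preserving composition, involution, tensor product and symmetry, and if $\rho_\bullet$ is a special object: for some $d_0\ge1$ there is $S\in(\iota_\bullet,\rho_\bullet^{d_0})$ with $S^*S=1$, $SS^*=P_{d_0}$ and $(S^*\otimes 1_{\rho_\bullet})(1_{\rho_\bullet}\otimes S)=(-1)^{d_0-1}d_0^{-1}1_{\rho_\bullet}$. Here $P_n=\frac1{n!}\sum_{p}\mathrm{sign}(p)\,\varepsilon_\rho(p)$ is the totally antisymmetric projection in $(\rho^n,\rho^n)$ of the category concerned, $\varepsilon_\rho(p)$ being the unitary which the symmetry associates with a permutation $p$ of $n$ objects. *The class $Q\widehat\rho$.* Let $d\ge1$, let $G\subseteq SU(d)$ be a closed subgroup, let $NG$ be its normalizer in $U(d)$ and $QG=NG/G$. Let $\widehat G$ be the category of tensor powers of $H=\mathbb C^d$ and $G$-equivariant linear maps, with the usual tensor product and the flip. For $y\in QG$ represented by $u\in NG$ put $\widehat y(t)=u^{\otimes s}\,t\,(u^{\otimes r})^*$ for $t\in(H^r,H^s)_G$. For a topological group $K$, $H^1(X,K)$ is the set of classes of $K$-cocycles $(\{X_i\},\{g_{ij}\})$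 on finite open covers, with $g_{ij}g_{jk}=g_{ik}$, modulo the relation $(g_{ij})\sim(g'_{lm})$ iff $g_{ij}u_{jm}=u_{il}g'_{lm}$ for some continuous $u_{il}:X_i\cap X'_l\to K$. The class of a $QG$-cocycle $(\{X_i\},\{y_{ij}\})$ is *associated with* $\widehat\rho$, and is denoted by $Q\widehat\rho\in H^1(X,QG)$, if there are local charts $\pi_i:\widehat\rho_{W_i}\to W_i\widehat G$ over closed sets $W_i\supseteq X_i$ with $\pi_i\circ\pi_j^{-1}=\widehat y_{ij}$ over $X_i\cap X_j$. Since $G\subseteq SU(d)$, the determinant factors through a continuous morphism $\det_Q:QG\to\mathbb T$, which induces $\det_{Q,*}:H^1(X,QG)\to H^1(X,\mathbb T)\simeq H^2(X,\mathbb Z)$, where the last map is the connecting map of $0\to\mathbb Z\to\mathbb R\to\mathbb T\to0$ (in Čech cohomology). *Twisted special object and Chern class.* $(\rho,d,\mathcal V)$ is a *twisted special object* if $\mathcal V\subseteq(\iota,\rho^d)$ is a closed subspace such that for all $V,V'\in\mathcal V$, $f\in(\iota,\iota)$: $f\otimes V=V\otimes f\in\mathcal V$; $(V^*\otimes1_\rho)(1_\rho\otimes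 V')=(-1)^{d-1}d^{-1}(V^*V')\otimes1_\rho$; and $\mathrm{span}\{V'V^*:V,V'\in\mathcal V\}=(\iota,\iota)\otimes P_d$. Its *Chern class* $c(\rho)\in H^2(X,\mathbb Z)$ is the image under $H^1(X,\mathbb T)\simeq H^2(X,\mathbb Z)$ of the class of the transition maps of a Hermitian line bundle over $X$ whose module of continuous sections is isomorphic to $\mathcal V$ as a Hilbert $C(X)$-module. **Statement.** Let $\widehat\rho$ be a special category, $d\ge1$, $G\subseteq SU(d)$ a closed subgroup, and let $Q\widehat\rho\in H^1(X,QG)$ be associated with $\widehat\rho$. Then there is exactly one $\mathcal V\subseteq(\iota,\rho^d)$ such that $(\rho,d,\mathcal V)$ is a twisted special object, it has exactly one Chern class, and $$c(\rho)=\det\nolimits_{Q,*}(Q\widehat\rho)\in H^2(X,\mathbb Z).$$ -/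

import Mathlib

/-- A `K`-cocycle on `X`: a finite open cover `U` and transition maps `g i j` (only their values on
`U i ∩ U j` matter), continuous on overlaps, with `g i j * g j k = g i k` on triple overlaps. -/
structure CechOneCocycle (X K : Type*) [TopologicalSpace X] [TopologicalSpace K] [Group K] where
  n : ℕ
  U : Fin n → Set X
  isOpen : ∀ i, IsOpen (U i)
  cover : ∀ x, ∃ i, x ∈ U i
  g : Fin n → Fin n → X → K
  cont : ∀ i j, ContinuousOn (g i j) (U i ∩ U j)
  mul_eq : ∀ i j k, ∀ x ∈ U i ∩ U j ∩ U k, g i j x * g j k x = g i k x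

namespace CechOneCocycle

variable {X K : Type*} [TopologicalSpace X] [TopologicalSpace K] [Group K]

theorem self_eq (c : CechOneCocycle X K) (i : Fin c.n) {x : X} (hx : x ∈ c.U i) :
    c.g i i x = 1 := by
  have h := c.mul_eq i i i x ⟨⟨hx, hx⟩, hx⟩
  exact mul_eq_left.mp h

/-- Equivalence of cocycles: there are continuous `u i l : U i ∩ U' l → K` with
`g i j * u j m = u i l * g' l m`. -/
def Equivalent (c c' : CechOneCocycle X K) : Prop :=
  ∃ u : Fin c.n → Fin c'.n → X → K,
    (∀ i l, ContinuousOn (u i l) (c.U i ∩ c'.U l)) ∧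
    ∀ i j l m, ∀ x ∈ c.U i ∩ c.U j ∩ (c'.U l ∩ c'.U m),
      c.g i j x * u j m x = u i l x * c'.g l m x

theorem equivalent_refl (c : CechOneCocycle X K) : Equivalent c c :=
  ⟨c.g, c.cont, fun i j l m x hx => by
    rw [c.mul_eq i j m x ⟨hx.1, hx.2.2⟩, c.mul_eq i l m x ⟨⟨hx.1.1, hx.2.1⟩, hx.2.2⟩]⟩

theorem equivalent_symm [IsTopologicalGroup K] {c c' : CechOneCocycle X K}
    (h : Equivalent c c') : Equivalent c' c := by
  obtain ⟨u, hu, h⟩ := h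
  refine ⟨fun l i x => (u i l x)⁻¹, fun l i => ?_, fun l m i j x hx => ?_⟩
  · rw [Set.inter_comm]
    exact (hu i l).inv
  · have := h i j l m x ⟨hx.2, hx.1⟩
    rw [eq_inv_mul_iff_mul_eq, ← mul_assoc, ← this, mul_inv_cancel_right]

theorem equivalent_trans [IsTopologicalGroup K] {c c' c'' : CechOneCocycle X K}
    (h : Equivalent c c') (h' : Equivalent c' c'') : Equivalent c c'' := by
  obtain ⟨u, hu, h⟩ := h
  obtain ⟨v, hv, h'⟩ := h'
  choose l hl using c'.cover
  have key : ∀ i p (x : X), x ∈ c.U i → x ∈ c''.U p → ∀ m, x ∈ c'.U m →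
      u i (l x) x * v (l x) p x = u i m x * v m p x := by
    intro i p x hi hp m hm
    have h1 := h i i (l x) m x ⟨⟨hi, hi⟩, hl x, hm⟩
    have h2 := h' (l x) m p p x ⟨⟨hl x, hm⟩, hp, hp⟩
    rw [c.self_eq i hi, one_mul] at h1
    rw [c''.self_eq p hp, mul_one] at h2
    rw [h1, mul_assoc, h2]
  refine ⟨fun i p x => u i (l x) x * v (l x) p x, fun i p x hx => ?_, fun i j p q x hx => ?_⟩
  · have hmem : (c.U i ∩ c''.U p) ∩ c'.U (l x) ∈ nhdsWithin x (c.U i ∩ c''.U p) :=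
      Filter.inter_mem self_mem_nhdsWithin
        (mem_nhdsWithin_of_mem_nhds ((c'.isOpen (l x)).mem_nhds (hl x)))
    have hc : ContinuousWithinAt (fun y => u i (l x) y * v (l x) p y)
        ((c.U i ∩ c''.U p)) x := by
      have e1 := (hu i (l x)).continuousAt
        (((c.isOpen i).inter (c'.isOpen (l x))).mem_nhds ⟨hx.1, hl x⟩)
      have e2 := (hv (l x) p).continuousAt
        (((c'.isOpen (l x)).inter (c''.isOpen p)).mem_nhds ⟨hl x, hx.2⟩)
      exact (e1.mul e2).continuousWithinAt
    refine hc.congr_of_eventuallyEq ?_ rfl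
    filter_upwards [hmem] with y hy
    exact key i p y hy.1.1 hy.1.2 (l x) hy.2
  · have h1 := h i j (l x) (l x) x ⟨hx.1, hl x, hl x⟩
    have h2 := h' (l x) (l x) p q x ⟨⟨hl x, hl x⟩, hx.2⟩
    rw [c'.self_eq _ (hl x), mul_one] at h1
    rw [c'.self_eq _ (hl x), one_mul] at h2
    change c.g i j x * (u j (l x) x * v (l x) q x) = u i (l x) x * v (l x) p x * c''.g p q x
    rw [← mul_assoc, h1, mul_assoc, h2]

instance setoid (X K : Type*) [TopologicalSpace X] [TopologicalSpace K] [Group K]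
    [IsTopologicalGroup K] : Setoid (CechOneCocycle X K) where
  r := Equivalent
  iseqv := ⟨equivalent_refl, equivalent_symm, equivalent_trans⟩

/-- The image of a cocycle under a continuous group homomorphism. -/
def map {L : Type*} [TopologicalSpace L] [Group L] (f : K →* L) (hf : Continuous f)
    (c : CechOneCocycle X K) : CechOneCocycle X L where
  n := c.n
  U := c.U
  isOpen := c.isOpen
  cover := c.cover
  g i j x := f (c.g i j x)
  cont i j := hf.comp_continuousOn (c.cont i j)
  mul_eq i j k x hx := by rw [← map_mul, c.mul_eq i j k x hx]

end CechOneCocycle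

/-- The cohomology set `H¹(X, K)`. -/
def HOne (X K : Type*) [TopologicalSpace X] [TopologicalSpace K] [Group K]
    [IsTopologicalGroup K] : Type _ := Quotient (CechOneCocycle.setoid X K)

namespace HOne

variable {X K L : Type*} [TopologicalSpace X] [TopologicalSpace K] [Group K]
  [IsTopologicalGroup K] [TopologicalSpace L] [Group L] [IsTopologicalGroup L]

/-- The class of a cocycle. -/
def mk (c : CechOneCocycle X K) : HOne X K := Quotient.mk _ c

/-- Functoriality of `H¹(X, ·)`. -/
def map (f : K →* L) (hf : Continuous f) : HOne X K → HOne X L :=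
  Quotient.map (CechOneCocycle.map f hf) (by
    rintro c c' ⟨u, hu, h⟩
    refine ⟨fun i l x => f (u i l x), fun i l => hf.comp_continuousOn (hu i l),
      fun i j l m x hx => ?_⟩
    change f _ * f _ = f _ * f _
    rw [← map_mul, h i j l m x hx, map_mul])

end HOne

/-- A Čech 2-cocycle on `X` with values in the constant sheaf `ℤ`, on a finite open cover. -/
structure CechTwoCocycle (X : Type*) [TopologicalSpace X] where
  n : ℕ
  U : Fin n → Set X
  isOpen : ∀ i, IsOpen (U i)
  cover : ∀ x, ∃ i, x ∈ U i
  c : Fin n → Fin n → Fin n → X → ℤ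
  cont : ∀ i j k, ContinuousOn (c i j k) (U i ∩ U j ∩ U k)
  cocycle : ∀ i j k l, ∀ x ∈ U i ∩ U j ∩ U k ∩ U l,
    c j k l x - c i k l x + c i j l x - c i j k x = 0

namespace CechTwoCocycle

variable {X : Type*} [TopologicalSpace X]

/-- Two Čech cocycles are cohomologous if their restrictions to a common finite refinement `W` of
the covers differ by the coboundary of a 1-cochain `m`. -/
def Cohomologous (c c' : CechTwoCocycle X) : Prop :=
  ∃ (κ : Type) (_ : Finite κ) (W : κ → Set X) (a : κ → Fin c.n) (b : κ → Fin c'.n)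
    (m : κ → κ → X → ℤ),
    (∀ p, IsOpen (W p)) ∧ (∀ x, ∃ p, x ∈ W p) ∧
    (∀ p, W p ⊆ c.U (a p) ∩ c'.U (b p)) ∧
    (∀ p q, ContinuousOn (m p q) (W p ∩ W q)) ∧
    ∀ p q r, ∀ x ∈ W p ∩ W q ∩ W r,
      c.c (a p) (a q) (a r) x - c'.c (b p) (b q) (b r) x = m q r x - m p r x + m p q x

theorem cohomologous_refl (c : CechTwoCocycle X) : Cohomologous c c :=
  ⟨Fin c.n, inferInstance, c.U, id, id, fun _ _ _ => 0, c.isOpen, c.cover,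
    fun _ _ hx => ⟨hx, hx⟩, fun _ _ => continuousOn_const, fun _ _ _ _ _ => by simp⟩

theorem cohomologous_symm {c c' : CechTwoCocycle X} (h : Cohomologous c c') :
    Cohomologous c' c := by
  obtain ⟨κ, hκ, W, a, b, m, hW, hcov, hsub, hm, h⟩ := h
  refine ⟨κ, hκ, W, b, a, fun p q x => - m p q x, hW, hcov, fun p x hx => (hsub p hx).symm,
    fun p q => (hm p q).neg, fun p q r x hx => ?_⟩
  have := h p q r x hx
  dsimp only
  linarith

theorem cohomologous_trans {c c' c'' : CechTwoCocycle X} (h : Cohomologous c c')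
    (h' : Cohomologous c' c'') : Cohomologous c c'' := by
  obtain ⟨κ, hκ, W, a, b, m, hW, hcov, hsub, hm, h⟩ := h
  obtain ⟨κ', hκ', W', a', b', m', hW', hcov', hsub', hm', h'⟩ := h'
  refine ⟨κ × κ', inferInstance, fun p => W p.1 ∩ W' p.2, fun p => a p.1, fun p => b' p.2,
    fun p q x => m p.1 q.1 x + m' p.2 q.2 x +
      (c'.c (b p.1) (b q.1) (a' q.2) x - c'.c (b p.1) (a' p.2) (a' q.2) x),
    fun p => (hW _).inter (hW' _), fun x => ?_, fun p x hx => ⟨(hsub _ hx.1).1, (hsub' _ hx.2).2⟩,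
    fun p q => ?_, fun p q r x hx => ?_⟩
  · obtain ⟨p, hp⟩ := hcov x
    obtain ⟨q, hq⟩ := hcov' x
    exact ⟨(p, q), hp, hq⟩
  · refine (((hm _ _).mono fun x hx => ⟨hx.1.1, hx.2.1⟩).add
      ((hm' _ _).mono fun x hx => ⟨hx.1.2, hx.2.2⟩)).add
      (((c'.cont _ _ _).mono fun x hx => ⟨⟨?_, ?_⟩, ?_⟩).sub
      ((c'.cont _ _ _).mono fun x hx => ⟨⟨?_, ?_⟩, ?_⟩))
    exacts [(hsub _ hx.1.1).2, (hsub _ hx.2.1).2, (hsub' _ hx.2.2).1, (hsub _ hx.1.1).2,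
      (hsub' _ hx.1.2).1, (hsub' _ hx.2.2).1]
  · obtain ⟨⟨⟨hp, hp'⟩, hq, hq'⟩, hr, hr'⟩ := hx
    have e := h p.1 q.1 r.1 x ⟨⟨hp, hq⟩, hr⟩
    have e' := h' p.2 q.2 r.2 x ⟨⟨hp', hq'⟩, hr'⟩
    have P := (hsub _ hp).2
    have Q := (hsub _ hq).2
    have R := (hsub _ hr).2
    have P' := (hsub' _ hp').1
    have Q' := (hsub' _ hq').1
    have R' := (hsub' _ hr').1
    have e1 := c'.cocycle (b p.1) (b q.1) (b r.1) (a' r.2) x ⟨⟨⟨P, Q⟩, R⟩, R'⟩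
    have e2 := c'.cocycle (b p.1) (b q.1) (a' q.2) (a' r.2) x ⟨⟨⟨P, Q⟩, Q'⟩, R'⟩
    have e3 := c'.cocycle (b p.1) (a' p.2) (a' q.2) (a' r.2) x ⟨⟨⟨P, P'⟩, Q'⟩, R'⟩
    dsimp only
    linarith

instance setoid (X : Type*) [TopologicalSpace X] : Setoid (CechTwoCocycle X) where
  r := Cohomologous
  iseqv := ⟨cohomologous_refl, cohomologous_symm, cohomologous_trans⟩

end CechTwoCocycle

/-- The Čech cohomology `H²(X, ℤ)` (of a compact space, so that finite covers suffice). -/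
def HTwoInt (X : Type*) [TopologicalSpace X] : Type _ := Quotient (CechTwoCocycle.setoid X)

/-- `c` is obtained from the circle-valued cocycle `g` by the recipe of the connecting map of
`0 → ℤ → ℝ → 𝕋 → 0`: on a refinement choose continuous logarithms `f i j` of the transition maps,
`exp (2πi f i j) = g i j`, and take their coboundary. -/
def IsLogCoboundary {X : Type*} [TopologicalSpace X] (g : CechOneCocycle X Circle)
    (c : CechTwoCocycle X) : Prop :=
  ∃ (a : Fin c.n → Fin g.n) (f : Fin c.n → Fin c.n → X → ℝ),
    (∀ i, c.U i ⊆ g.U (a i)) ∧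
    (∀ i j, ContinuousOn (f i j) (c.U i ∩ c.U j)) ∧
    (∀ i j, ∀ x ∈ c.U i ∩ c.U j, Circle.exp (2 * Real.pi * f i j x) = g.g (a i) (a j) x) ∧
    ∀ i j k, ∀ x ∈ c.U i ∩ c.U j ∩ c.U k, (c.c i j k x : ℝ) = f j k x - f i k x + f i j x

theorem continuousOn_of_int_cast {X : Type*} [TopologicalSpace X] {s : Set X} {n : X → ℤ}
    (h : ContinuousOn (fun x => (n x : ℝ)) s) : ContinuousOn n s :=
  Int.isClosedEmbedding_coe_real.isInducing.continuousOn_iff.mpr h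

theorem circle_exp_eq_one {t : ℝ} (h : Circle.exp (2 * Real.pi * t) = 1) : ∃ n : ℤ, (n : ℝ) = t := by
  obtain ⟨n, hn⟩ := Circle.exp_eq_one.mp h
  refine ⟨n, ?_⟩
  have := Real.two_pi_pos
  have h3 : 2 * Real.pi * (n : ℝ) = 2 * Real.pi * t := by linarith
  exact mul_left_cancel₀ this.ne' h3

/-- Continuous circle-valued functions have continuous logarithms locally. -/
theorem exists_log_nhds {X : Type*} [TopologicalSpace X] {U : Set X} (hU : IsOpen U)
    {g : X → Circle} (hg : ContinuousOn g U) {x : X} (hx : x ∈ U) :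
    ∃ N : Set X, IsOpen N ∧ x ∈ N ∧ N ⊆ U ∧ ∃ f : X → ℝ, ContinuousOn f N ∧
      ∀ y ∈ N, Circle.exp (2 * Real.pi * f y) = g y := by
  let q : X → ℂ := fun y => ((g y / g x : Circle) : ℂ)
  have hq : ContinuousOn q U :=
    continuous_subtype_val.comp_continuousOn (hg.div' continuousOn_const)
  refine ⟨U ∩ q ⁻¹' Complex.slitPlane, hq.isOpen_inter_preimage hU Complex.isOpen_slitPlane,
    ⟨hx, by simp [q]⟩, Set.inter_subset_left,
    fun y => (Complex.arg (q y) + Complex.arg (g x)) / (2 * Real.pi), ?_, ?_⟩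
  · refine ContinuousOn.div_const (ContinuousOn.add ?_ continuousOn_const) _
    intro y hy
    exact ((Complex.continuousAt_arg hy.2).comp_continuousWithinAt
      ((hq y hy.1).mono Set.inter_subset_left))
  · intro y hy
    have h2 : 2 * Real.pi * ((Complex.arg (q y) + Complex.arg (g x)) / (2 * Real.pi)) =
        Complex.arg (q y) + Complex.arg (g x) := by
      field_simp
    rw [h2, Circle.exp_add, Circle.exp_arg, Circle.exp_arg, div_mul_cancel]

theorem exists_isLogCoboundary {X : Type*} [TopologicalSpace X] [CompactSpace X] [T2Space X]
    (g : CechOneCocycle X Circle) : ∃ c, IsLogCoboundary g c := by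
  classical
  obtain ⟨W, hWcov, hWo, hWsub⟩ := exists_iUnion_eq_closure_subset g.isOpen
    (fun x => Set.toFinite _) (Set.iUnion_eq_univ_iff.mpr g.cover)
  have hW : ∀ x, ∃ i, x ∈ W i := Set.iUnion_eq_univ_iff.mp hWcov
  choose φ hφ using hW
  -- around every point, all transition maps have logarithms
  have hlog : ∀ (x : X) (i j : Fin g.n), ∃ N : Set X, IsOpen N ∧ x ∈ N ∧
      (x ∈ g.U i ∩ g.U j → N ⊆ g.U i ∩ g.U j ∧ ∃ f : X → ℝ, ContinuousOn f N ∧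
        ∀ y ∈ N, Circle.exp (2 * Real.pi * f y) = g.g i j y) := by
    intro x i j
    by_cases hx : x ∈ g.U i ∩ g.U j
    · obtain ⟨N, h1, h2, h3, h4⟩ :=
        exists_log_nhds ((g.isOpen i).inter (g.isOpen j)) (g.cont i j) hx
      exact ⟨N, h1, h2, fun _ => ⟨h3, h4⟩⟩
    · exact ⟨Set.univ, isOpen_univ, trivial, fun h => absurd h hx⟩
  choose N hNo hNx hN using hlog
  let V : X → Set X := fun x => W (φ x) ∩ ((⋂ i, ⋂ j, N x i j) ∩
    ⋂ i, {y | x ∈ closure (W i) ∨ y ∉ closure (W i)})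
  have hVo : ∀ x, IsOpen (V x) := by
    intro x
    refine (hWo _).inter ((isOpen_iInter_of_finite fun i => isOpen_iInter_of_finite fun j =>
      hNo x i j).inter (isOpen_iInter_of_finite fun i => ?_))
    by_cases h : x ∈ closure (W i)
    · simp [h]
    · have e : {y | x ∈ closure (W i) ∨ y ∉ closure (W i)} = (closure (W i))ᶜ := by
        ext y
        simp [h]
      rw [e]
      exact isClosed_closure.isOpen_compl
  have hVx : ∀ x, x ∈ V x := by
    intro x
    refine ⟨hφ x, Set.mem_iInter₂.mpr fun i j => hNx x i j, Set.mem_iInter.mpr fun i => ?_⟩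
    by_cases h : x ∈ closure (W i)
    · exact Or.inl h
    · exact Or.inr h
  obtain ⟨t, ht⟩ := isCompact_univ.elim_finite_subcover V hVo
    (fun x _ => Set.mem_iUnion.mpr ⟨x, hVx x⟩)
  let e := t.equivFin
  let pt : Fin t.card → X := fun i => (e.symm i : X)
  have hcov : ∀ x, ∃ i, x ∈ V (pt i) := by
    intro x
    obtain ⟨y, hy, hxy⟩ := Set.mem_iUnion₂.mp (ht (Set.mem_univ x))
    exact ⟨e ⟨y, hy⟩, by simpa [pt] using hxy⟩
  have hf : ∀ i j : Fin t.card, ∃ f : X → ℝ, ContinuousOn f (V (pt i) ∩ V (pt j)) ∧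
      ∀ y ∈ V (pt i) ∩ V (pt j),
        Circle.exp (2 * Real.pi * f y) = g.g (φ (pt i)) (φ (pt j)) y := by
    intro i j
    by_cases hne : ∃ z, z ∈ V (pt i) ∩ V (pt j)
    · obtain ⟨z, hz1, hz2⟩ := hne
      have h1 : pt i ∈ closure (W (φ (pt j))) := by
        rcases Set.mem_iInter.mp hz1.2.2 (φ (pt j)) with h | h
        · exact h
        · exact absurd (subset_closure hz2.1) h
      obtain ⟨_, f, hf, hf'⟩ := hN (pt i) (φ (pt i)) (φ (pt j))
        ⟨hWsub _ (subset_closure (hφ _)), hWsub _ h1⟩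
      have hs : V (pt i) ∩ V (pt j) ⊆ N (pt i) (φ (pt i)) (φ (pt j)) := fun y hy =>
        Set.mem_iInter₂.mp hy.1.2.1 _ _
      exact ⟨f, hf.mono hs, fun y hy => hf' y (hs hy)⟩
    · refine ⟨fun _ => 0, continuousOn_const, fun y hy => absurd ⟨y, hy⟩ hne⟩
  choose f hfc hfe using hf
  have hsub : ∀ i, V (pt i) ⊆ g.U (φ (pt i)) := fun i y hy => hWsub _ (subset_closure hy.1)
  have hint : ∀ i j k, ∀ x ∈ V (pt i) ∩ V (pt j) ∩ V (pt k),
      ((round (f j k x - f i k x + f i j x) : ℤ) : ℝ) = f j k x - f i k x + f i j x := by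
    rintro i j k x ⟨⟨hi, hj⟩, hk⟩
    obtain ⟨m, hm⟩ := circle_exp_eq_one (t := f j k x - f i k x + f i j x) (by
      have e0 : 2 * Real.pi * (f j k x - f i k x + f i j x) = 2 * Real.pi * f j k x -
        2 * Real.pi * f i k x + 2 * Real.pi * f i j x := by ring
      rw [e0, Circle.exp_add, Circle.exp_sub, hfe j k x ⟨hj, hk⟩, hfe i k x ⟨hi, hk⟩,
        hfe i j x ⟨hi, hj⟩, ← g.mul_eq _ _ _ x ⟨⟨hsub i hi, hsub j hj⟩, hsub k hk⟩]
      simp [div_eq_mul_inv])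
    rw [← hm, round_intCast]
  refine ⟨⟨t.card, fun i => V (pt i), fun i => hVo _, hcov,
    fun i j k x => round (f j k x - f i k x + f i j x), fun i j k => ?_,
    fun i j k l x hx => ?_⟩, fun i => φ (pt i), f, hsub, hfc, hfe, hint⟩
  · refine continuousOn_of_int_cast (ContinuousOn.congr (f := fun x =>
      f j k x - f i k x + f i j x) ?_ (hint i j k))
    exact (((hfc j k).mono fun x hx => ⟨hx.1.2, hx.2⟩).sub
      ((hfc i k).mono fun x hx => ⟨hx.1.1, hx.2⟩)).add ((hfc i j).mono fun x hx => hx.1)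
  · obtain ⟨⟨⟨hi, hj⟩, hk⟩, hl⟩ := hx
    have e1 := hint j k l x ⟨⟨hj, hk⟩, hl⟩
    have e2 := hint i k l x ⟨⟨hi, hk⟩, hl⟩
    have e3 := hint i j l x ⟨⟨hi, hj⟩, hl⟩
    have e4 := hint i j k x ⟨⟨hi, hj⟩, hk⟩
    have : ((round (f k l x - f j l x + f j k x) - round (f k l x - f i l x + f i k x) +
        round (f j l x - f i l x + f i j x) - round (f j k x - f i k x + f i j x) : ℤ) : ℝ) =
        ((0 : ℤ) : ℝ) := by
      push_cast
      rw [e1, e2, e3, e4]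
      ring
    exact_mod_cast this

theorem IsLogCoboundary.cohomologous {X : Type*} [TopologicalSpace X] [CompactSpace X]
    {g g' : CechOneCocycle X Circle} (hg : CechOneCocycle.Equivalent g g')
    {c c' : CechTwoCocycle X} (h : IsLogCoboundary g c) (h' : IsLogCoboundary g' c') :
    CechTwoCocycle.Cohomologous c c' := by
  classical
  obtain ⟨u, hu, hg⟩ := hg
  obtain ⟨a, f, hs, hfc, hfe, hc⟩ := h
  obtain ⟨a', f', hs', hfc', hfe', hc'⟩ := h'
  choose p hp using c.cover
  choose p' hp' using c'.cover
  have hloc : ∀ x, ∃ N : Set X, IsOpen N ∧ x ∈ N ∧ N ⊆ c.U (p x) ∩ c'.U (p' x) ∧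
      ∃ h : X → ℝ, ContinuousOn h N ∧
        ∀ y ∈ N, Circle.exp (2 * Real.pi * h y) = u (a (p x)) (a' (p' x)) y := fun x =>
    exists_log_nhds ((c.isOpen (p x)).inter (c'.isOpen (p' x)))
      ((hu _ _).mono fun y hy => ⟨hs _ hy.1, hs' _ hy.2⟩) ⟨hp x, hp' x⟩
  choose N hNo hNx hNs h hhc hhe using hloc
  obtain ⟨t, ht⟩ := isCompact_univ.elim_finite_subcover N hNo
    (fun x _ => Set.mem_iUnion.mpr ⟨x, hNx x⟩)
  let e := t.equivFin
  let pt : Fin t.card → X := fun i => (e.symm i : X)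
  have hcov : ∀ x, ∃ i, x ∈ N (pt i) := by
    intro x
    obtain ⟨y, hy, hxy⟩ := Set.mem_iUnion₂.mp (ht (Set.mem_univ x))
    exact ⟨e ⟨y, hy⟩, by simpa [pt] using hxy⟩
  let r : Fin t.card → Fin t.card → X → ℝ := fun i j x =>
    f (p (pt i)) (p (pt j)) x + h (pt j) x - h (pt i) x - f' (p' (pt i)) (p' (pt j)) x
  have hint : ∀ i j, ∀ x ∈ N (pt i) ∩ N (pt j), ((round (r i j x) : ℤ) : ℝ) = r i j x := by
    rintro i j x ⟨hi, hj⟩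
    have i1 := hNs _ hi
    have j1 := hNs _ hj
    have hcomm := hg (a (p (pt i))) (a (p (pt j))) (a' (p' (pt i))) (a' (p' (pt j))) x
      ⟨⟨hs _ i1.1, hs _ j1.1⟩, hs' _ i1.2, hs' _ j1.2⟩
    obtain ⟨m, hm⟩ := circle_exp_eq_one (t := r i j x) (by
      have e0 : 2 * Real.pi * r i j x = (2 * Real.pi * f (p (pt i)) (p (pt j)) x +
        2 * Real.pi * h (pt j) x) - (2 * Real.pi * h (pt i) x +
          2 * Real.pi * f' (p' (pt i)) (p' (pt j)) x) := by
        simp only [r]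
        ring
      rw [e0, Circle.exp_sub, Circle.exp_add, Circle.exp_add, hhe _ x hi, hhe _ x hj,
        hfe _ _ x ⟨i1.1, j1.1⟩, hfe' _ _ x ⟨i1.2, j1.2⟩, hcomm, div_self'])
    rw [← hm, round_intCast]
  refine ⟨Fin t.card, inferInstance, fun i => N (pt i), fun i => p (pt i), fun i => p' (pt i),
    fun i j x => round (r i j x), fun i => hNo _, hcov, fun i => hNs _, fun i j => ?_,
    fun i j k x hx => ?_⟩
  · refine continuousOn_of_int_cast (ContinuousOn.congr (f := r i j) ?_ (hint i j))
    exact ((((hfc _ _).mono fun x hx => ⟨(hNs _ hx.1).1, (hNs _ hx.2).1⟩).add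
      ((hhc _).mono fun x hx => hx.2)).sub ((hhc _).mono fun x hx => hx.1)).sub
      ((hfc' _ _).mono fun x hx => ⟨(hNs _ hx.1).2, (hNs _ hx.2).2⟩)
  · obtain ⟨⟨hi, hj⟩, hk⟩ := hx
    have e1 := hint j k x ⟨hj, hk⟩
    have e2 := hint i k x ⟨hi, hk⟩
    have e3 := hint i j x ⟨hi, hj⟩
    have e4 := hc _ _ _ x ⟨⟨(hNs _ hi).1, (hNs _ hj).1⟩, (hNs _ hk).1⟩
    have e5 := hc' _ _ _ x ⟨⟨(hNs _ hi).2, (hNs _ hj).2⟩, (hNs _ hk).2⟩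
    have : ((c.c (p (pt i)) (p (pt j)) (p (pt k)) x -
        c'.c (p' (pt i)) (p' (pt j)) (p' (pt k)) x : ℤ) : ℝ) =
        ((round (r j k x) - round (r i k x) + round (r i j x) : ℤ) : ℝ) := by
      push_cast
      rw [e1, e2, e3, e4, e5]
      simp only [r]
      ring
    exact_mod_cast this

/-- The canonical isomorphism `H¹(X, 𝕋) ≃ H²(X, ℤ)`, as the connecting map of the exponential
sequence `0 → ℤ → ℝ → 𝕋 → 0`, for compact Hausdorff `X`. -/
noncomputable def connectingMap {X : Type*} [TopologicalSpace X] [CompactSpace X] [T2Space X] :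
    HOne X Circle → HTwoInt X :=
  Quotient.lift
    (fun g => (Quotient.mk (CechTwoCocycle.setoid X) (exists_isLogCoboundary g).choose : HTwoInt X))
    (fun _ _ hg => Quotient.sound (IsLogCoboundary.cohomologous hg
      (exists_isLogCoboundary _).choose_spec (exists_isLogCoboundary _).choose_spec))
universe u v

/-- Transport of arrows along equalities of objects. -/
def castArrow {H : ℕ → ℕ → Type u} {r s r' s' : ℕ} (hr : r = r') (hs : s = s') (t : H r s) :
    H r' s' :=
  cast (congrArg₂ H hr hs) t

/-- A (strict, unital) symmetric tensor C*-category generated by one object `ρ`: the objects are the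
tensor powers `ρ^r`, `r ∈ ℕ` (with `ι = ρ^0`), and `Hom r s` is the space of arrows `(ρ^r, ρ^s)`. -/
structure SymTensorCStarCat where
  Hom : ℕ → ℕ → Type u
  instNormed : ∀ r s, NormedAddCommGroup (Hom r s)
  instSpace : ∀ r s, NormedSpace ℂ (Hom r s)
  instComplete : ∀ r s, CompleteSpace (Hom r s)
  /-- identity arrows -/
  one : ∀ r, Hom r r
  /-- composition `comp b a = b ∘ a` -/
  comp : ∀ {r s t}, Hom s t →ₗ[ℂ] Hom r s →ₗ[ℂ] Hom r t
  /-- the involution -/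
  adj : ∀ {r s}, Hom r s →ₛₗ[starRingEnd ℂ] Hom s r
  /-- the tensor product of arrows -/
  tensor : ∀ {r s r' s'}, Hom r s →ₗ[ℂ] Hom r' s' →ₗ[ℂ] Hom (r + r') (s + s')
  /-- the symmetry -/
  sym : ∀ r s, Hom (r + s) (s + r)
  one_comp : ∀ {r s} (a : Hom r s), comp (one s) a = a
  comp_one : ∀ {r s} (a : Hom r s), comp a (one r) = a
  comp_assoc : ∀ {q r s t} (c : Hom s t) (b : Hom r s) (a : Hom q r),
    comp (comp c b) a = comp c (comp b a)
  norm_comp_le : ∀ {r s t} (b : Hom s t) (a : Hom r s), ‖comp b a‖ ≤ ‖b‖ * ‖a‖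
  adj_adj : ∀ {r s} (a : Hom r s), adj (adj a) = a
  adj_comp : ∀ {r s t} (b : Hom s t) (a : Hom r s), adj (comp b a) = comp (adj a) (adj b)
  norm_adj_comp_self : ∀ {r s} (a : Hom r s), ‖comp (adj a) a‖ = ‖a‖ ^ 2
  /-- `a* ∘ a` is a positive element of the C*-algebra `(ρ^r, ρ^r)` -/
  adj_comp_self_pos : ∀ {r s} (a : Hom r s), ∃ b : Hom r r, comp (adj a) a = comp (adj b) b
  tensor_one : ∀ r s, tensor (one r) (one s) = one (r + s)
  tensor_comp : ∀ {r s t r' s' t'} (b : Hom s t) (a : Hom r s) (b' : Hom s' t') (a' : Hom r' s'),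
    tensor (comp b a) (comp b' a') = comp (tensor b b') (tensor a a')
  adj_tensor : ∀ {r s r' s'} (a : Hom r s) (b : Hom r' s'),
    adj (tensor a b) = tensor (adj a) (adj b)
  tensor_assoc : ∀ {r s r' s' r'' s''} (a : Hom r s) (b : Hom r' s') (c : Hom r'' s''),
    castArrow (Nat.add_assoc r r' r'') (Nat.add_assoc s s' s'') (tensor (tensor a b) c) =
      tensor a (tensor b c)
  one_tensor : ∀ {r s} (a : Hom r s),
    castArrow (Nat.zero_add r) (Nat.zero_add s) (tensor (one 0) a) = a
  tensor_one_zero : ∀ {r s} (a : Hom r s), tensor a (one 0) = a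
  sym_natural : ∀ {r s r' s'} (a : Hom r s) (b : Hom r' s'),
    comp (sym s s') (tensor a b) = comp (tensor b a) (sym r r')
  sym_sym : ∀ r s, comp (sym s r) (sym r s) = one (r + s)
  adj_sym : ∀ r s, adj (sym r s) = sym s r
  sym_zero : ∀ r, castArrow rfl (Nat.zero_add r) (sym r 0) = one r
  sym_tensor : ∀ r s t, sym (r + s) t =
    castArrow (Nat.add_assoc r s t).symm (Nat.add_assoc t r s)
      (comp (tensor (sym r t) (one s))
        (castArrow rfl (Nat.add_assoc r t s).symm (tensor (one r) (sym s t))))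

namespace SymTensorCStarCat

attribute [instance] instNormed instSpace instComplete

variable (T : SymTensorCStarCat.{u})

/-- The commutative C*-algebra `(ι, ι)`. -/
def Scalars : Type u := T.Hom 0 0

noncomputable instance : NormedAddCommGroup T.Scalars := T.instNormed 0 0
noncomputable instance : NormedSpace ℂ T.Scalars := T.instSpace 0 0
instance : CompleteSpace T.Scalars := T.instComplete 0 0

theorem scalars_mul_comm (f g : T.Hom 0 0) : T.comp f g = T.comp g f := by
  have h1 : ∀ a : T.Hom 0 0, T.tensor (T.one 0) a = a := fun a => T.one_tensor a
  have h2 := T.tensor_comp f (T.one 0) (T.one 0) g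
  have h3 := T.tensor_comp (T.one 0) f g (T.one 0)
  rw [T.comp_one, T.one_comp] at h2 h3
  rw [T.tensor_one_zero, h1] at h2 h3
  exact h2.symm.trans h3

theorem add_comp {r s t : ℕ} (f g : T.Hom s t) (h : T.Hom r s) :
    T.comp (f + g) h = T.comp f h + T.comp g h := by
  rw [map_add, LinearMap.add_apply]

theorem zero_comp {r s t : ℕ} (f : T.Hom r s) : T.comp (0 : T.Hom s t) f = 0 := by
  rw [map_zero, LinearMap.zero_apply]

theorem smul_one_comp {r s : ℕ} (c : ℂ) (f : T.Hom r s) : T.comp (c • T.one s) f = c • f := by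
  rw [map_smul, LinearMap.smul_apply, T.one_comp]

theorem norm_mul_self_le {r s : ℕ} (f : T.Hom r s) : ‖f‖ * ‖f‖ ≤ ‖T.comp (T.adj f) f‖ := by
  rw [T.norm_adj_comp_self, sq]

theorem adj_smul {r s : ℕ} (c : ℂ) (f : T.Hom r s) : T.adj (c • f) = star c • T.adj f :=
  LinearMap.map_smulₛₗ T.adj c f

noncomputable instance : NormedCommRing T.Scalars where
  mul f g := T.comp f g
  one := T.one 0
  left_distrib f g h := map_add (T.comp f) g h
  right_distrib f g h := T.add_comp f g h
  zero_mul f := T.zero_comp f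
  mul_zero f := map_zero (T.comp f)
  mul_assoc f g h := T.comp_assoc f g h
  one_mul f := T.one_comp f
  mul_one f := T.comp_one f
  mul_comm f g := T.scalars_mul_comm f g
  norm_mul_le f g := T.norm_comp_le f g
  dist_eq := (T.instNormed 0 0).dist_eq

noncomputable instance : StarRing T.Scalars where
  star f := T.adj f
  star_involutive f := T.adj_adj f
  star_mul f g := T.adj_comp f g
  star_add f g := map_add T.adj f g

instance : CStarRing T.Scalars where
  norm_mul_self_le f := T.norm_mul_self_le (r := 0) (s := 0) f

noncomputable instance : NormedAlgebra ℂ T.Scalars where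
  algebraMap :=
    { toFun := fun c => c • T.one 0
      map_one' := one_smul ℂ (T.one 0)
      map_mul' := fun a b =>
        ((T.smul_one_comp a (b • T.one 0)).trans (smul_smul a b (T.one 0))).symm
      map_zero' := zero_smul ℂ (T.one 0)
      map_add' := fun a b => add_smul a b (T.one 0) }
  smul c f := c • f
  commutes' _ _ := T.scalars_mul_comm _ _
  smul_def' c f := (T.smul_one_comp (r := 0) c f).symm
  norm_smul_le c f := (T.instSpace 0 0).norm_smul_le c f

instance : StarModule ℂ T.Scalars where
  star_smul c f := T.adj_smul (r := 0) (s := 0) c f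

noncomputable instance : CommCStarAlgebra T.Scalars where

/-- The base space: the spectrum `X` of `(ι, ι)`, so that `(ι, ι) = C(X)`. -/
abbrev Spec : Type u := WeakDual.characterSpace ℂ T.Scalars

/-- Evaluation of a scalar arrow, seen as a continuous function on the spectrum. -/
noncomputable def eval (x : T.Spec) (f : T.Hom 0 0) : ℂ := x (show T.Scalars from f)


/-- The action of scalars on arrows, `f t = t ⊗ f` (`= f ⊗ t` by symmetry). -/
def scal {r s : ℕ} (f : T.Hom 0 0) (t : T.Hom r s) : T.Hom r s := T.tensor t f

/-- The unitary `ε_ρ(p) ∈ (ρ^n, ρ^n)` of a permutation `p`. Writing `k = p 0`, one has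
`p = (cycle 0 ↦ k, j ↦ j - 1 for 1 ≤ j ≤ k) * (1 × e)` with `e` a permutation of the other `n - 1`
points, and the cycle is represented by `ε(ρ, ρ^k) ⊗ 1`. -/
noncomputable def perm : (n : ℕ) → Equiv.Perm (Fin n) → T.Hom n n
  | 0, _ => T.one 0
  | n + 1, p =>
    T.comp
      (castArrow (r := 1 + (p 0 : ℕ) + (n - p 0)) (s := (p 0 : ℕ) + 1 + (n - p 0))
        (by have := (p 0).isLt; omega) (by have := (p 0).isLt; omega)
        (T.tensor (T.sym 1 (p 0)) (T.one (n - p 0))))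
      (castArrow (Nat.add_comm 1 n) (Nat.add_comm 1 n)
        (T.tensor (T.one 1)
          (perm n (Equiv.Perm.decomposeFin ((p 0).cycleRange * p)).2)))

/-- The totally antisymmetric projection `P = (1/n!) ∑ sign(p) ε_ρ(p)`. -/
noncomputable def antisym (n : ℕ) : T.Hom n n :=
  ((n.factorial : ℂ)⁻¹) • ∑ p : Equiv.Perm (Fin n), ((Equiv.Perm.sign p : ℤ) : ℂ) • T.perm n p

/-- `(V* ⊗ 1_ρ) ∘ (1_ρ ⊗ W) ∈ (ρ, ρ)` for `V W ∈ (ι, ρ^d)`. -/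
noncomputable def contract {d : ℕ} (V W : T.Hom 0 d) : T.Hom 1 1 :=
  T.comp (r := 1) (s := d + 1) (t := 1)
    (castArrow rfl (Nat.zero_add 1) (T.tensor (T.adj V) (T.one 1)))
    (castArrow rfl (Nat.add_comm 1 d) (T.tensor (T.one 1) W))

/-- `(ρ, d, V)` is a special object. -/
def IsSpecialObject (d : ℕ) (V : T.Hom 0 d) : Prop :=
  1 ≤ d ∧ T.comp (T.adj V) V = T.one 0 ∧ T.comp V (T.adj V) = T.antisym d ∧
    T.contract V V = ((-1 : ℂ) ^ (d - 1) * (d : ℂ)⁻¹) • T.one 1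

/-- `(ρ, d, V)` is a twisted special object. -/
def IsTwistedSpecialObject (d : ℕ) (V : Submodule ℂ (T.Hom 0 d)) : Prop :=
  1 ≤ d ∧ IsClosed (V : Set (T.Hom 0 d)) ∧
    (∀ v ∈ V, ∀ f : T.Hom 0 0,
      castArrow (Nat.zero_add 0) (Nat.zero_add d) (T.tensor f v) = T.tensor v f ∧
        T.tensor v f ∈ V) ∧
    (∀ v ∈ V, ∀ w ∈ V, T.contract v w =
      ((-1 : ℂ) ^ (d - 1) * (d : ℂ)⁻¹) •
        castArrow (Nat.zero_add 1) (Nat.zero_add 1)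
          (T.tensor (T.comp (T.adj v) w) (T.one 1))) ∧
    (Submodule.span ℂ {t : T.Hom d d | ∃ v ∈ V, ∃ w ∈ V, t = T.comp w (T.adj v)} :
      Set (T.Hom d d)) =
      {t | ∃ f : T.Hom 0 0,
        t = castArrow (Nat.zero_add d) (Nat.zero_add d) (T.tensor f (T.antisym d))}

/-- The kernel of the restriction of arrows to a closed subset `W` of the spectrum: the closed span
of the arrows `f t` with `f` a function vanishing on `W`. -/
noncomputable def vanishing (W : Set T.Spec) (r s : ℕ) : Submodule ℂ (T.Hom r s) :=
  (Submodule.span ℂ {a : T.Hom r s | ∃ (f : T.Hom 0 0) (t : T.Hom r s),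
    (∀ x ∈ W, T.eval x f = 0) ∧ a = T.scal f t}).topologicalClosure

/-- A local chart over a closed set `W` of the spectrum `X`: a `C(W)`-linear isomorphism of
symmetric tensor C*-categories from the restriction `T_W` to the constant bundle `W F`, which maps
`ρ` to the generating object of `F`. Since `Hom_W = Hom / vanishing W`, it is given as a surjective
functor on `T` whose kernel is `vanishing W`. -/
structure LocalChart (F : SymTensorCStarCat.{v}) (W : Set T.Spec) where
  map : ∀ {r s}, T.Hom r s →ₗ[ℂ] C(W, F.Hom r s)
  map_one : ∀ r (x : W), map (T.one r) x = F.one r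
  map_comp : ∀ {r s t} (b : T.Hom s t) (a : T.Hom r s) (x : W),
    map (T.comp b a) x = F.comp (map b x) (map a x)
  map_adj : ∀ {r s} (a : T.Hom r s) (x : W), map (T.adj a) x = F.adj (map a x)
  map_tensor : ∀ {r s r' s'} (a : T.Hom r s) (b : T.Hom r' s') (x : W),
    map (T.tensor a b) x = F.tensor (map a x) (map b x)
  map_sym : ∀ r s (x : W), map (T.sym r s) x = F.sym r s
  map_scal : ∀ {r s} (f : T.Hom 0 0) (a : T.Hom r s) (x : W),
    map (T.scal f a) x = T.eval x f • map a x
  surjective : ∀ r s, Function.Surjective (map (r := r) (s := s))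
  ker_eq : ∀ r s, LinearMap.ker (map (r := r) (s := s)) = T.vanishing W r s

/-- `T` is locally trivial with fibre `F` (a category with simple identity object). -/
def IsLocallyTrivial (F : SymTensorCStarCat.{v}) : Prop :=
  F.one 0 ≠ 0 ∧ (∀ f : F.Hom 0 0, ∃ z : ℂ, f = z • F.one 0) ∧
    ∀ x : T.Spec, ∃ W : Set T.Spec, IsClosed W ∧ W ∈ nhds x ∧ Nonempty (T.LocalChart F W)

/-- `T` is a special category with fibre `F`. -/
def IsSpecialCategory (F : SymTensorCStarCat.{v}) : Prop :=
  T.IsLocallyTrivial F ∧ ∃ (d : ℕ) (V : F.Hom 0 d), F.IsSpecialObject d V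

end SymTensorCStarCat

/-- Linear maps `H^r → H^s` on tensor powers of `H = ℂ^d`, as matrices. -/
abbrev TMat (d r s : ℕ) : Type := Matrix (Fin s → Fin d) (Fin r → Fin d) ℂ

namespace TMat

open Matrix

variable {d : ℕ}

/-- The tensor product of two linear maps, `H^(r + r') = H^r ⊗ H^r'` being the concatenation of
multi-indices. -/
def tensor {r s r' s' : ℕ} (a : TMat d r s) (b : TMat d r' s') : TMat d (r + r') (s + s') :=
  (Matrix.kroneckerMap (· * ·) a b).submatrix (Fin.appendEquiv s s').symm
    (Fin.appendEquiv r r').symm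

/-- The flip `v ⊗ w ↦ w ⊗ v` from `H^r ⊗ H^s` to `H^s ⊗ H^r`. -/
def flip (d r s : ℕ) : TMat d (r + s) (s + r) :=
  Matrix.of fun I J => if I = J ∘ finAddFlip then 1 else 0

/-- The tensor power `u ⊗ ⋯ ⊗ u` on `H^r`. -/
def tpow (u : Matrix (Fin d) (Fin d) ℂ) (r : ℕ) : TMat d r r :=
  Matrix.of fun I J => ∏ k, u (I k) (J k)

theorem tensor_apply {r s r' s' : ℕ} (a : TMat d r s) (b : TMat d r' s') (I J) :
    tensor a b I J = a (I ∘ Fin.castAdd s') (J ∘ Fin.castAdd r') *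
      b (I ∘ Fin.natAdd s) (J ∘ Fin.natAdd r) := rfl

theorem tensor_mul {r s t r' s' t' : ℕ} (b : TMat d s t) (a : TMat d r s) (b' : TMat d s' t')
    (a' : TMat d r' s') : tensor (b * a) (b' * a') = tensor b b' * tensor a a' := by
  unfold tensor
  rw [Matrix.submatrix_mul_equiv]
  congr 1
  exact Matrix.mul_kronecker_mul b a b' a'

theorem tensor_one (r s : ℕ) : tensor (1 : TMat d r r) (1 : TMat d s s) = 1 := by
  unfold tensor
  have : (Matrix.kroneckerMap (· * ·) (1 : TMat d r r) (1 : TMat d s s)) = 1 :=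
    Matrix.one_kronecker_one
  rw [this, Matrix.submatrix_one_equiv]

theorem tensor_conjTranspose {r s r' s' : ℕ} (a : TMat d r s) (b : TMat d r' s') :
    (tensor a b)ᴴ = tensor aᴴ bᴴ := by
  ext I J
  simp [tensor_apply, Matrix.conjTranspose_apply]

theorem castArrow_apply {r s r' s' : ℕ} (hr : r = r') (hs : s = s') (a : TMat d r s) (I J) :
    castArrow (H := TMat d) hr hs a I J = a (I ∘ Fin.cast hs) (J ∘ Fin.cast hr) := by
  subst hr hs
  rfl

theorem tensor_assoc {r s r' s' r'' s'' : ℕ} (a : TMat d r s) (b : TMat d r' s')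
    (c : TMat d r'' s'') :
    castArrow (H := TMat d) (Nat.add_assoc r r' r'') (Nat.add_assoc s s' s'')
      (tensor (tensor a b) c) = tensor a (tensor b c) := by
  ext I J
  rw [castArrow_apply]
  simp only [tensor_apply, mul_assoc]
  congr 1
  congr 1
  congr 1 <;> ext k <;> simp [Fin.natAdd, Fin.cast, Nat.add_assoc]

theorem one_tensor {r s : ℕ} (a : TMat d r s) :
    castArrow (H := TMat d) (Nat.zero_add r) (Nat.zero_add s) (tensor (1 : TMat d 0 0) a) = a := by
  ext I J
  have h : ∀ A B : Fin 0 → Fin d, (1 : TMat d 0 0) A B = 1 := fun A B => by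
    rw [Subsingleton.elim A B, Matrix.one_apply_eq]
  rw [castArrow_apply, tensor_apply, h, one_mul]
  congr 1 <;> ext k <;> simp [Fin.cast]

theorem tensor_one_zero {r s : ℕ} (a : TMat d r s) : tensor a (1 : TMat d 0 0) = a := by
  ext I J
  rw [tensor_apply, Subsingleton.elim (_ ∘ Fin.natAdd s : Fin 0 → Fin d) (_ ∘ Fin.natAdd r),
    Matrix.one_apply_eq, mul_one]
  rfl

/-- The operator on tensors which permutes the factors by a bijection `σ`. -/
def pm (d : ℕ) {m n : ℕ} (σ : Fin n ≃ Fin m) : TMat d m n :=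
  Matrix.of fun I J => if I = J ∘ σ then 1 else 0

theorem flip_eq (r s : ℕ) : flip d r s = pm d finAddFlip := rfl

theorem one_eq (r : ℕ) : (1 : TMat d r r) = pm d (Equiv.refl _) := by
  ext I J
  simp [pm, Matrix.one_apply]

theorem pm_mul {m n l : ℕ} (σ : Fin n ≃ Fin m) (M : TMat d l m) (I J) :
    (pm d σ * M) I J = M (I ∘ σ.symm) J := by
  rw [Matrix.mul_apply, Finset.sum_eq_single (I ∘ σ.symm)]
  · simp [pm, Function.comp_assoc]
  · intro K _ hK
    have : I ≠ K ∘ σ := by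
      rintro rfl
      exact hK (by simp [Function.comp_assoc])
    simp [pm, this]
  · simp

theorem mul_pm {m n l : ℕ} (σ : Fin n ≃ Fin m) (M : TMat d n l) (I J) :
    (M * pm d σ) I J = M I (J ∘ σ) := by
  rw [Matrix.mul_apply, Finset.sum_eq_single (J ∘ σ)]
  · simp [pm]
  · intro K _ hK
    simp [pm, hK]
  · simp

theorem flip_natural {r s r' s' : ℕ} (a : TMat d r s) (b : TMat d r' s') :
    flip d s s' * tensor a b = tensor b a * flip d r r' := by
  ext I J
  rw [flip_eq, flip_eq, pm_mul, mul_pm, tensor_apply, tensor_apply, mul_comm]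
  congr 2 <;> ext k <;> simp [finAddFlip]

theorem flip_flip (r s : ℕ) : flip d s r * flip d r s = 1 := by
  ext I J
  rw [flip_eq, flip_eq, pm_mul]
  simp only [pm, Matrix.of_apply, Matrix.one_apply]
  refine if_congr ?_ rfl rfl
  constructor
  · intro h
    ext k
    have := congrFun h (finAddFlip k)
    simpa [finAddFlip] using congrArg Fin.val this
  · rintro rfl
    ext k
    simp [finAddFlip]

theorem conjTranspose_flip (r s : ℕ) : (flip d r s)ᴴ = flip d s r := by
  ext I J
  simp only [flip, Matrix.conjTranspose_apply, Matrix.of_apply]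
  rw [apply_ite star, star_one, star_zero]
  refine if_congr ?_ rfl rfl
  constructor <;>
  · rintro rfl
    ext k
    simp [finAddFlip]

theorem flip_zero (r : ℕ) :
    castArrow (H := TMat d) rfl (Nat.zero_add r) (flip d r 0) = 1 := by
  ext I J
  rw [castArrow_apply]
  simp only [flip, Matrix.of_apply, Matrix.one_apply]
  refine if_congr ?_ rfl rfl
  have hk : ∀ k : Fin r, (finAddFlip (m := 0) (n := r) (Fin.cast (Nat.zero_add r).symm k)) = k := by
    intro k
    have : (Fin.cast (Nat.zero_add r).symm k) = Fin.natAdd 0 k := by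
      ext
      simp
    rw [this, finAddFlip_apply_natAdd]
    rfl
  constructor
  · intro h
    ext k
    have := congrFun h (Fin.cast (Nat.zero_add r).symm k)
    simp only [Function.comp_apply, hk] at this
    exact congrArg Fin.val this
  · rintro rfl
    ext k
    have := hk (Fin.cast (Nat.zero_add r) k)
    simp only [Fin.cast_cast, Fin.cast_eq_self] at this
    simp [this]

theorem finAddFlip_val {m n : ℕ} (k : Fin (m + n)) :
    (finAddFlip k : ℕ) = if (k : ℕ) < m then n + k else k - m := by
  refine Fin.addCases (fun i => ?_) (fun i => ?_) k <;> simp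

/-- The bijection acting by `σ` on the first and by `τ` on the second summand. -/
def finSumCongr {r s r' s' : ℕ} (σ : Fin s ≃ Fin r) (τ : Fin s' ≃ Fin r') :
    Fin (s + s') ≃ Fin (r + r') :=
  finSumFinEquiv.symm.trans ((Equiv.sumCongr σ τ).trans finSumFinEquiv)

theorem finSumCongr_val {r s r' s' : ℕ} (σ : Fin s ≃ Fin r) (τ : Fin s' ≃ Fin r')
    (k : Fin (s + s')) : (finSumCongr σ τ k : ℕ) =
      if h : (k : ℕ) < s then (σ ⟨k, h⟩ : ℕ) else r + τ ⟨k - s, by omega⟩ := by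
  refine Fin.addCases (fun i => ?_) (fun i => ?_) k <;> simp [finSumCongr]

theorem tensor_pm {r s r' s' : ℕ} (σ : Fin s ≃ Fin r) (τ : Fin s' ≃ Fin r') :
    tensor (pm d σ) (pm d τ) = pm d (finSumCongr σ τ) := by
  ext I J
  rw [tensor_apply]
  simp only [pm, Matrix.of_apply]
  rw [ite_zero_mul_ite_zero, mul_one]
  refine if_congr ?_ rfl rfl
  rw [funext_iff, funext_iff, funext_iff, Fin.forall_fin_add]
  simp [finSumCongr]

theorem castArrow_pm {r s r' s' : ℕ} (hr : r = r') (hs : s = s') (σ : Fin s ≃ Fin r) :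
    castArrow (H := TMat d) hr hs (pm d σ) =
      pm d ((finCongr hs.symm).trans (σ.trans (finCongr hr))) := by
  subst hr hs
  rfl

theorem pm_mul_pm {m n l : ℕ} (σ : Fin n ≃ Fin m) (τ : Fin m ≃ Fin l) :
    pm d σ * pm d τ = pm d (σ.trans τ) := by
  ext I J
  rw [mul_pm]
  rfl

theorem flip_tensor (r s t : ℕ) : flip d (r + s) t =
    castArrow (H := TMat d) (Nat.add_assoc r s t).symm (Nat.add_assoc t r s)
      (tensor (flip d r t) (1 : TMat d s s) *
        castArrow (H := TMat d) rfl (Nat.add_assoc r t s).symm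
          (tensor (1 : TMat d r r) (flip d s t))) := by
  rw [one_eq, one_eq, flip_eq, flip_eq, flip_eq, tensor_pm, tensor_pm, castArrow_pm, pm_mul_pm,
    castArrow_pm]
  congr 1
  ext k
  have := k.isLt
  simp only [Equiv.trans_apply, finCongr_apply, Fin.val_cast, finSumCongr_val, finAddFlip_val,
    Equiv.refl_apply]
  split_ifs <;> omega

theorem tpow_add (u : Matrix (Fin d) (Fin d) ℂ) (r s : ℕ) :
    tpow u (r + s) = tensor (tpow u r) (tpow u s) := by
  ext I J
  simp [tpow, tensor_apply, Fin.prod_univ_add]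

theorem tpow_mul (u v : Matrix (Fin d) (Fin d) ℂ) (r : ℕ) :
    tpow (u * v) r = tpow u r * tpow v r := by
  ext I J
  simp only [tpow, Matrix.of_apply, Matrix.mul_apply, Finset.prod_univ_sum,
    Fintype.piFinset_univ, Finset.prod_mul_distrib]

theorem tpow_conjTranspose (u : Matrix (Fin d) (Fin d) ℂ) (r : ℕ) :
    (tpow u r)ᴴ = tpow uᴴ r := by
  ext I J
  simp [tpow, Matrix.conjTranspose_apply]

theorem tpow_flip (u : Matrix (Fin d) (Fin d) ℂ) (r s : ℕ) :
    tpow u (s + r) * flip d r s = flip d r s * tpow u (r + s) := by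
  rw [tpow_add, tpow_add, flip_natural]

section

open scoped Matrix.Norms.L2Operator MatrixOrder ComplexOrder

theorem exists_sqrt {m n : Type} [Fintype m] [DecidableEq m] [Fintype n] [DecidableEq n]
    (t : Matrix m n ℂ) :
    ∃ b : Matrix n n ℂ, tᴴ * t = bᴴ * b ∧ ∀ w, Commute (tᴴ * t) w → Commute b w := by
  have h0 : 0 ≤ tᴴ * t := (Matrix.posSemidef_conjTranspose_mul_self t).nonneg
  refine ⟨CFC.sqrt (tᴴ * t), ?_, fun w hw => ?_⟩
  · have h1 : (CFC.sqrt (tᴴ * t))ᴴ = CFC.sqrt (tᴴ * t) :=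
      (CFC.sqrt_nonneg (tᴴ * t)).isSelfAdjoint
    rw [h1, CFC.sqrt_mul_sqrt_self _ h0]
  · exact Commute.cfcₙ_nnreal hw _

end

end TMat

section DualCategory

open Matrix

variable {d : ℕ}

/-- The `G`-equivariant maps `(H^r, H^s)_G`. -/
def equivariantMaps (G : Subgroup (Matrix.unitaryGroup (Fin d) ℂ)) (r s : ℕ) :
    Submodule ℂ (TMat d r s) where
  carrier := {t | ∀ g ∈ G, TMat.tpow g.1 s * t = t * TMat.tpow g.1 r}
  add_mem' ha hb g hg := by rw [Matrix.mul_add, Matrix.add_mul, ha g hg, hb g hg]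
  zero_mem' g _ := by rw [Matrix.mul_zero, Matrix.zero_mul]
  smul_mem' c a ha g hg := by rw [Matrix.mul_smul, Matrix.smul_mul, ha g hg]

theorem castArrow_coe (G : Subgroup (Matrix.unitaryGroup (Fin d) ℂ)) {r s r' s' : ℕ}
    (hr : r = r') (hs : s = s') (a : equivariantMaps G r s) :
    (castArrow (H := fun r s => equivariantMaps G r s) hr hs a : TMat d r' s') =
      castArrow (H := TMat d) hr hs (a : TMat d r s) := by
  subst hr hs
  rfl

open scoped Matrix.Norms.L2Operator in
/-- The category `Ĝ` for a group `G ⊆ U(d)`: the tensor powers of `H = ℂ^d` and the `G`-equivariant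
linear maps (with operator norm, adjoint, usual tensor product, and flip). -/
noncomputable def dualCategory (G : Subgroup (Matrix.unitaryGroup (Fin d) ℂ)) :
    SymTensorCStarCat.{0} where
  Hom r s := equivariantMaps G r s
  instNormed r s := inferInstance
  instSpace r s := inferInstance
  instComplete r s := FiniteDimensional.complete ℂ _
  one r := ⟨1, fun g _ => by rw [Matrix.mul_one, Matrix.one_mul]⟩
  comp {r s t} := LinearMap.mk₂ ℂ (fun b a => ⟨b.1 * a.1, fun g hg => by
      rw [← Matrix.mul_assoc, b.2 g hg, Matrix.mul_assoc, a.2 g hg, Matrix.mul_assoc]⟩)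
    (fun _ _ _ => Subtype.ext (Matrix.add_mul _ _ _))
    (fun _ _ _ => Subtype.ext (Matrix.smul_mul _ _ _))
    (fun _ _ _ => Subtype.ext (Matrix.mul_add _ _ _))
    (fun _ _ _ => Subtype.ext (Matrix.mul_smul _ _ _))
  adj {r s} :=
    { toFun := fun a => ⟨a.1ᴴ, fun g hg => by
        have h := congrArg Matrix.conjTranspose (a.2 g⁻¹ (G.inv_mem hg))
        rw [Matrix.conjTranspose_mul, Matrix.conjTranspose_mul, TMat.tpow_conjTranspose,
          TMat.tpow_conjTranspose] at h
        have e : ((g⁻¹ : Matrix.unitaryGroup (Fin d) ℂ).1)ᴴ = g.1 :=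
          Matrix.conjTranspose_conjTranspose g.1
        rw [e] at h
        exact h.symm⟩
      map_add' := fun a b => Subtype.ext (Matrix.conjTranspose_add a.1 b.1)
      map_smul' := fun c a => Subtype.ext (Matrix.conjTranspose_smul c a.1) }
  tensor {r s r' s'} := LinearMap.mk₂ ℂ (fun a b => ⟨TMat.tensor a.1 b.1, fun g hg => by
      rw [TMat.tpow_add, TMat.tpow_add, ← TMat.tensor_mul, ← TMat.tensor_mul, a.2 g hg,
        b.2 g hg]⟩)
    (fun _ _ _ => Subtype.ext (by ext I J; simp [TMat.tensor_apply, add_mul]))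
    (fun _ _ _ => Subtype.ext (by ext I J; simp [TMat.tensor_apply, mul_assoc]))
    (fun _ _ _ => Subtype.ext (by ext I J; simp [TMat.tensor_apply, mul_add]))
    (fun _ _ _ => Subtype.ext (by ext I J; simp [TMat.tensor_apply, mul_left_comm]))
  sym r s := ⟨TMat.flip d r s, fun g _ => TMat.tpow_flip g.1 r s⟩
  one_comp a := Subtype.ext (Matrix.one_mul a.1)
  comp_one a := Subtype.ext (Matrix.mul_one a.1)
  comp_assoc c b a := Subtype.ext (Matrix.mul_assoc c.1 b.1 a.1)
  norm_comp_le b a := Matrix.l2_opNorm_mul b.1 a.1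
  adj_adj a := Subtype.ext (Matrix.conjTranspose_conjTranspose a.1)
  adj_comp b a := Subtype.ext (Matrix.conjTranspose_mul b.1 a.1)
  norm_adj_comp_self a := (Matrix.l2_opNorm_conjTranspose_mul_self a.1).trans (sq ‖a.1‖).symm
  adj_comp_self_pos {r s} a := by
    obtain ⟨b, hb, hcomm⟩ := TMat.exists_sqrt a.1
    refine ⟨⟨b, fun g hg => ((hcomm (TMat.tpow g.1 r) ?_).eq).symm⟩, Subtype.ext hb⟩
    have h := congrArg Matrix.conjTranspose (a.2 g⁻¹ (G.inv_mem hg))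
    rw [Matrix.conjTranspose_mul, Matrix.conjTranspose_mul, TMat.tpow_conjTranspose,
      TMat.tpow_conjTranspose] at h
    have e : ((g⁻¹ : Matrix.unitaryGroup (Fin d) ℂ).1)ᴴ = g.1 :=
      Matrix.conjTranspose_conjTranspose g.1
    rw [e] at h
    change a.1ᴴ * a.1 * TMat.tpow g.1 r = TMat.tpow g.1 r * (a.1ᴴ * a.1)
    rw [Matrix.mul_assoc, ← a.2 g hg, ← Matrix.mul_assoc, ← Matrix.mul_assoc, h]
  tensor_one r s := Subtype.ext (TMat.tensor_one r s)
  tensor_comp b a b' a' := Subtype.ext (TMat.tensor_mul b.1 a.1 b'.1 a'.1)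
  adj_tensor a b := Subtype.ext (TMat.tensor_conjTranspose a.1 b.1)
  tensor_assoc a b c := Subtype.ext ((castArrow_coe G _ _ _).trans
    (TMat.tensor_assoc a.1 b.1 c.1))
  one_tensor a := Subtype.ext ((castArrow_coe G _ _ _).trans (TMat.one_tensor a.1))
  tensor_one_zero a := Subtype.ext (TMat.tensor_one_zero a.1)
  sym_natural a b := Subtype.ext (TMat.flip_natural a.1 b.1)
  sym_sym r s := Subtype.ext (TMat.flip_flip r s)
  adj_sym r s := Subtype.ext (TMat.conjTranspose_flip r s)
  sym_zero r := Subtype.ext ((castArrow_coe G _ _ _).trans (TMat.flip_zero r))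
  sym_tensor r s t := Subtype.ext ((TMat.flip_tensor r s t).trans (by
    refine Eq.trans ?_ (castArrow_coe G _ _ _).symm
    congr 2
    exact (castArrow_coe G rfl (Nat.add_assoc r t s).symm
      ⟨TMat.tensor (1 : TMat d r r) (TMat.flip d s t), fun g _ => by
        rw [TMat.tpow_add _ r (t + s), TMat.tpow_add _ r (s + t), ← TMat.tensor_mul,
          ← TMat.tensor_mul, TMat.tpow_flip, Matrix.mul_one, Matrix.one_mul]⟩).symm))

/-- The normalizer `NG` of `G` in `U(d)`. -/
abbrev NGroup (G : Subgroup (Matrix.unitaryGroup (Fin d) ℂ)) :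
    Subgroup (Matrix.unitaryGroup (Fin d) ℂ) :=
  Subgroup.normalizer (G : Set (Matrix.unitaryGroup (Fin d) ℂ))

/-- The quotient `QG = NG / G`, with the quotient topology. -/
abbrev QGroup (G : Subgroup (Matrix.unitaryGroup (Fin d) ℂ)) : Type :=
  NGroup G ⧸ G.subgroupOf (NGroup G)

/-- The determinant `U(d) → 𝕋`. -/
noncomputable def detCircle (d : ℕ) : Matrix.unitaryGroup (Fin d) ℂ →* Circle where
  toFun u := ⟨u.1.det, mem_sphere_zero_iff_norm.mpr
    (CStarRing.norm_of_mem_unitary (Matrix.det_of_mem_unitary u.2))⟩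
  map_one' := Subtype.ext Matrix.det_one
  map_mul' u v := Subtype.ext (Matrix.det_mul u.1 v.1)

theorem continuous_detCircle (d : ℕ) : Continuous (detCircle d) :=
  Continuous.subtype_mk (continuous_subtype_val.matrix_det) _

/-- The morphism `det_Q : QG → 𝕋` through which the determinant factors if `G ⊆ SU(d)`. -/
noncomputable def detQ (G : Subgroup (Matrix.unitaryGroup (Fin d) ℂ))
    (hG : ∀ g ∈ G, (g : Matrix (Fin d) (Fin d) ℂ).det = 1) : QGroup G →* Circle :=
  QuotientGroup.lift _ ((detCircle d).comp (NGroup G).subtype)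
    (fun _ hu => Subtype.ext (hG _ (Subgroup.mem_subgroupOf.mp hu)))

theorem continuous_detQ (G : Subgroup (Matrix.unitaryGroup (Fin d) ℂ))
    (hG : ∀ g ∈ G, (g : Matrix (Fin d) (Fin d) ℂ).det = 1) : Continuous (detQ G hG) :=
  continuous_quot_lift _ ((continuous_detCircle d).comp continuous_subtype_val)

end DualCategory

namespace SymTensorCStarCat

variable (T : SymTensorCStarCat.{u})

/-- `q ∈ H¹(X, QG)` is the class `Q T` of `T`: it is represented by a cocycle `y` such that there
are local charts `π i : T → W i Ĝ` on closed sets `W i ⊇ U i` which satisfy `π i ∘ (π j)⁻¹ = ŷ i j`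
over `U i ∩ U j`, where `û t = u^{⊗ s} ∘ t ∘ (u^{⊗ r})*` for `u ∈ NG` with class `y`. -/
def IsAssociatedClass {d : ℕ} (G : Subgroup (Matrix.unitaryGroup (Fin d) ℂ))
    (q : HOne T.Spec (QGroup G)) : Prop :=
  ∃ (y : CechOneCocycle T.Spec (QGroup G)) (W : Fin y.n → Set T.Spec)
    (hU : ∀ i, y.U i ⊆ W i) (π : ∀ i, T.LocalChart (dualCategory G) (W i)),
    HOne.mk y = q ∧ (∀ i, IsClosed (W i)) ∧
    ∀ (i j : Fin y.n) (x : T.Spec) (hi : x ∈ y.U i) (hj : x ∈ y.U j) (u : NGroup G),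
      (QuotientGroup.mk u : QGroup G) = y.g i j x →
      ∀ (r s : ℕ) (t : T.Hom r s),
        ((π i).map t ⟨x, hU i hi⟩).1 =
          TMat.tpow u.1.1 s * ((π j).map t ⟨x, hU j hj⟩).1 *
            Matrix.conjTranspose (TMat.tpow u.1.1 r)

/-- A continuous section of the Hermitian line bundle `L_g` with transition maps `g`, in local
coordinates: `s i = g i j * s j` on overlaps (and `s i` is set to zero outside of `U i`). -/
def IsLineBundleSection {X : Type*} [TopologicalSpace X] (g : CechOneCocycle X Circle)
    (s : Fin g.n → X → ℂ) : Prop :=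
  (∀ i, ContinuousOn (s i) (g.U i)) ∧ (∀ i, ∀ x ∉ g.U i, s i x = 0) ∧
    ∀ i j, ∀ x ∈ g.U i ∩ g.U j, s i x = g.g i j x * s j x

/-- The Hilbert `(ι, ι)`-module `V ⊆ (ι, ρ^d)` is isomorphic to the module of continuous sections
of the Hermitian line bundle over `X` with transition maps `g`. -/
def IsSectionModule {d : ℕ} (V : Submodule ℂ (T.Hom 0 d)) (g : CechOneCocycle T.Spec Circle) :
    Prop :=
  ∃ Φ : V →ₗ[ℂ] (Fin g.n → T.Spec → ℂ),
    Function.Injective Φ ∧ (∀ s, IsLineBundleSection g s ↔ ∃ v, Φ v = s) ∧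
    (∀ (f : T.Hom 0 0) (v w : V), (w : T.Hom 0 d) = T.scal f v →
      ∀ i x, Φ w i x = T.eval x f * Φ v i x) ∧
    ∀ (v w : V) i, ∀ x ∈ g.U i,
      T.eval x (T.comp (T.adj (v : T.Hom 0 d)) w) = star (Φ v i x) * Φ w i x

/-- `c ∈ H²(X, ℤ)` is the Chern class of the twisted special object `(ρ, d, V)`: the image under
`H¹(X, 𝕋) ≃ H²(X, ℤ)` of the class of the transition maps of the line bundle over `X` whose module
of continuous sections is `V`. -/
def IsChernClass {d : ℕ} (V : Submodule ℂ (T.Hom 0 d)) (c : HTwoInt T.Spec) : Prop :=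
  ∃ g : CechOneCocycle T.Spec Circle, T.IsSectionModule V g ∧ connectingMap (HOne.mk g) = c

end SymTensorCStarCat

/-! The argument is fibrewise. In `(ℂ^d)^{⊗d}` the totally antisymmetric projection has rank one: it
projects onto the line spanned by the normalized antisymmetric tensor S (`antisymTensor`), and
`u^{⊗d}` multiplies S by `det u` (`tpow_mul_antisymTensor`). Since `G ⊆ SU(d)`, S is an arrow of
`Ĝ`, so every chart lifts it to a local frame of antisymmetric arrows. From one chart to another,
the coefficient along S is multiplied by `det_Q` of the transition map. The arrows fixed by `P_d`
(`antisymArrows`) are therefore exactly the continuous sections of the Hermitian line bundle with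
cocycle `det_Q y` (`isSectionModule`).

The axioms of a twisted special object reduce to matrix identities for S: `S*S = 1`, `SS* = P_d` and
the conjugate equation (`contract_antisymTensor`). The reduction is legitimate because an arrow
which vanishes in all charts is zero (`DualAtlas.eq_zero`, by a partition of unity).

Uniqueness of the submodule follows from the span axiom: it forces every `v` in it to satisfy `P_d v
= v`, and it puts `P_d` in the span of the `w v*`, which gives the other inclusion
(`eq_antisymArrows`). The Chern class is unique because a Hilbert module that is non-zero at every
point determines the cocycle of its line bundle up to equivalence: quotients of coordinates of a
common section are the required phases (`IsSectionModule.equivalent`). -/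

namespace TMat

open Matrix

variable {d : ℕ}

/-! ### Levi-Civita symbols and the antisymmetric tensor in the d-th tensor power of `ℂ^d`. -/

/-- The Levi-Civita symbol of a multi-index. -/
noncomputable def leviCivita (d : ℕ) (I : Fin d → Fin d) : ℂ :=
  ((1 : Matrix (Fin d) (Fin d) ℂ).submatrix I id).det

theorem star_leviCivita (I : Fin d → Fin d) : star (leviCivita d I) = leviCivita d I := by
  rw [leviCivita, ← Matrix.det_conjTranspose, ← Matrix.det_transpose]
  congr 1
  ext i j
  simp only [Matrix.transpose_apply, Matrix.conjTranspose_apply, Matrix.submatrix_apply,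
    Matrix.one_apply]
  split_ifs <;> simp

/-- A Cauchy–Binet formula, with the sum over all choices of rows. -/
theorem sum_det_submatrix_mul_det_submatrix {ι : Type*} [Fintype ι] {m : ℕ}
    (A B : Matrix ι (Fin m) ℂ) :
    ∑ L : Fin m → ι, (A.submatrix L id).det * (B.submatrix L id).det =
      m.factorial * (Aᵀ * B).det := by
  classical
  have h1 : ∀ (M : Matrix ι (Fin m) ℂ) (L : Fin m → ι), (M.submatrix L id).det =
      ∑ p : Equiv.Perm (Fin m), ((Equiv.Perm.sign p : ℤ) : ℂ) * ∏ k, M (L k) (p k) := by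
    intro M L
    rw [← Matrix.det_transpose, Matrix.det_apply']
    rfl
  have h2 : ∀ p q : Equiv.Perm (Fin m),
      ∑ L : Fin m → ι, (∏ k, A (L k) (p k)) * ∏ k, B (L k) (q k) =
        ∏ k, (Aᵀ * B) (p k) (q k) := by
    intro p q
    simp only [Matrix.mul_apply, Finset.prod_univ_sum, Fintype.piFinset_univ,
      Finset.prod_mul_distrib, Matrix.transpose_apply]
  -- For fixed `p` the sum over `q` is the determinant with rows permuted by `p`. Its sign cancels
  -- against the sign carried by `p`, so each of the `m!` permutations contributes one full
  -- determinant.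
  have h3 : ∀ p : Equiv.Perm (Fin m), ∑ q : Equiv.Perm (Fin m),
      ((Equiv.Perm.sign q : ℤ) : ℂ) * ∏ k, (Aᵀ * B) (p k) (q k) =
        ((Equiv.Perm.sign p : ℤ) : ℂ) * (Aᵀ * B).det := by
    intro p
    rw [← Matrix.det_permute, ← Matrix.det_transpose, Matrix.det_apply']
    rfl
  calc _ = ∑ p : Equiv.Perm (Fin m), ∑ q : Equiv.Perm (Fin m),
        (((Equiv.Perm.sign p : ℤ) : ℂ) * ((Equiv.Perm.sign q : ℤ) : ℂ)) *
          ∑ L : Fin m → ι, (∏ k, A (L k) (p k)) * ∏ k, B (L k) (q k) := by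
        simp only [h1, Finset.sum_mul_sum]
        simp only [Finset.mul_sum]
        rw [Finset.sum_comm]
        refine Finset.sum_congr rfl fun p _ => ?_
        rw [Finset.sum_comm]
        refine Finset.sum_congr rfl fun q _ => Finset.sum_congr rfl fun L _ => ?_
        ring
    _ = ∑ p : Equiv.Perm (Fin m), (Aᵀ * B).det := by
        refine Finset.sum_congr rfl fun p _ => ?_
        simp only [h2, mul_assoc, ← Finset.mul_sum, h3]
        rw [← mul_assoc, ← Int.cast_mul, ← Units.val_mul, Int.units_mul_self]
        simp
    _ = _ := by
        rw [Finset.sum_const, Finset.card_univ, Fintype.card_perm, Fintype.card_fin,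
          nsmul_eq_mul]

/-- A product of determinants is the determinant of the matrix with entries `[I a = J b]`. Its
Leibniz term for `p` is non-zero exactly if `I ∘ p = J`, that is `I = J ∘ p⁻¹`, hence the inverse
permutation. -/
theorem leviCivita_mul_leviCivita (I J : Fin d → Fin d) :
    leviCivita d I * leviCivita d J =
      ∑ p : Equiv.Perm (Fin d), ((Equiv.Perm.sign p : ℤ) : ℂ) * pm d p.symm I J := by
  rw [leviCivita, leviCivita, ← Matrix.det_transpose (submatrix _ J id), ← Matrix.det_mul,
    Matrix.det_apply']
  refine Finset.sum_congr rfl fun p _ => ?_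
  congr 1
  have h : ∀ a b, (submatrix (1 : Matrix (Fin d) (Fin d) ℂ) I id *
      (submatrix (1 : Matrix (Fin d) (Fin d) ℂ) J id)ᵀ) a b = if I a = J b then 1 else 0 := by
    intro a b
    simp [Matrix.mul_apply, Matrix.one_apply, eq_comm]
  simp only [h, pm, Matrix.of_apply, Finset.prod_ite_zero, Finset.prod_const_one]
  refine if_congr ?_ rfl rfl
  constructor
  · intro h
    ext k
    simpa using congrArg Fin.val (h (p.symm k) (Finset.mem_univ _))
  · rintro rfl k -
    simp

/-- Both sides are the determinant of the matrix whose rows are the rows of `u` selected by `I`: on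
the right by multiplicativity, on the left by the Leibniz formula, as only multi-indices `J` that
are permutations contribute. -/
theorem sum_prod_mul_leviCivita (u : Matrix (Fin d) (Fin d) ℂ) (I : Fin d → Fin d) :
    ∑ J : Fin d → Fin d, (∏ k, u (I k) (J k)) * leviCivita d J = u.det * leviCivita d I := by
  have h1 : u.det * leviCivita d I = (u.submatrix I id).det := by
    rw [leviCivita, mul_comm, ← Matrix.det_mul]
    congr 1
    ext i j
    simp [Matrix.mul_apply, Matrix.one_apply]
  have h2 : ∀ J, leviCivita d J = ∑ p : Equiv.Perm (Fin d),
      ((Equiv.Perm.sign p : ℤ) : ℂ) * if J = p then 1 else 0 := by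
    intro J
    rw [leviCivita, ← Matrix.det_transpose, Matrix.det_apply']
    refine Finset.sum_congr rfl fun p _ => ?_
    congr 1
    simp only [Matrix.transpose_apply, Matrix.submatrix_apply, Matrix.one_apply, id,
      Finset.prod_ite_zero, Finset.prod_const_one]
    exact if_congr (by simp [funext_iff]) rfl rfl
  rw [h1, ← Matrix.det_transpose, Matrix.det_apply']
  simp only [h2, Finset.mul_sum]
  rw [Finset.sum_comm]
  refine Finset.sum_congr rfl fun p _ => ?_
  rw [Finset.sum_eq_single (p : Fin d → Fin d)]
  · simp [mul_comm]
  · intro J _ hJ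
    simp [hJ]
  · simp

/-- The normalized totally antisymmetric tensor in `H^d`, `H = ℂ^d`. -/
noncomputable def antisymTensor (d : ℕ) : TMat d 0 d :=
  Matrix.of fun I _ => (((Real.sqrt d.factorial)⁻¹ : ℝ) : ℂ) * leviCivita d I

theorem inv_sqrt_factorial_mul_self (n : ℕ) :
    (((Real.sqrt n.factorial)⁻¹ : ℝ) : ℂ) * (((Real.sqrt n.factorial)⁻¹ : ℝ) : ℂ) =
      (n.factorial : ℂ)⁻¹ := by
  rw [← Complex.ofReal_mul, ← mul_inv, Real.mul_self_sqrt (Nat.cast_nonneg _)]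
  simp

theorem star_antisymTensor (I J) : star (antisymTensor d I J) = antisymTensor d I J := by
  rw [antisymTensor, Matrix.of_apply, star_mul', star_leviCivita]
  congr 1
  exact Complex.conj_ofReal _

/-- The source of the determinant in the Chern class. For `u ∈ G ⊆ SU(d)` it says that S is
invariant; for `u ∈ NG` it gives the transition maps of the line bundle. -/
theorem tpow_mul_antisymTensor (u : Matrix (Fin d) (Fin d) ℂ) :
    tpow u d * antisymTensor d = u.det • antisymTensor d := by
  ext I J
  rw [Matrix.mul_apply, Matrix.smul_apply, smul_eq_mul]
  simp only [antisymTensor, tpow, Matrix.of_apply]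
  rw [mul_left_comm, ← sum_prod_mul_leviCivita, Finset.mul_sum]
  exact Finset.sum_congr rfl fun J _ => by ring

/-- The right side is the form that `P_d` takes in a fibre (see `fibre_perm`), so `P_d` becomes a
rank-one operator. -/
theorem antisymTensor_mul_conjTranspose : antisymTensor d * (antisymTensor d)ᴴ =
    ((d.factorial : ℂ)⁻¹) •
      ∑ p : Equiv.Perm (Fin d), ((Equiv.Perm.sign p : ℤ) : ℂ) • pm d p.symm := by
  ext I J
  rw [Matrix.mul_apply, Matrix.smul_apply, Matrix.sum_apply, Fintype.sum_unique]
  simp only [Matrix.conjTranspose_apply, star_antisymTensor, Matrix.smul_apply, smul_eq_mul]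
  rw [← leviCivita_mul_leviCivita, ← inv_sqrt_factorial_mul_self]
  simp only [antisymTensor, Matrix.of_apply]
  ring

/-- Cauchy–Binet for two identity matrices: the squares of the symbols sum to `d!`, which is what
the normalization divides by. -/
theorem conjTranspose_mul_antisymTensor : (antisymTensor d)ᴴ * antisymTensor d = 1 := by
  ext I J
  rw [Subsingleton.elim I J, Matrix.one_apply_eq, Matrix.mul_apply]
  simp only [Matrix.conjTranspose_apply, star_antisymTensor]
  simp only [antisymTensor, Matrix.of_apply]
  have h := sum_det_submatrix_mul_det_submatrix (1 : Matrix (Fin d) (Fin d) ℂ) 1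
  rw [Matrix.transpose_one, Matrix.mul_one, Matrix.det_one, mul_one] at h
  have hd : (d.factorial : ℂ) ≠ 0 := Nat.cast_ne_zero.mpr d.factorial_ne_zero
  calc _ = (d.factorial : ℂ)⁻¹ * ∑ L : Fin d → Fin d, leviCivita d L * leviCivita d L := by
        rw [← inv_sqrt_factorial_mul_self, Finset.mul_sum]
        exact Finset.sum_congr rfl fun L _ => by ring
    _ = 1 := by
        simp only [leviCivita]
        rw [h, inv_mul_cancel₀ hd]

/-- Moving the last index to the front is a cyclic rotation of `m + 1` places, of sign `(-1)^m`.
This is the sign `(-1)^(d-1)` in the conjugate equation. -/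
theorem leviCivita_snoc {m : ℕ} (L : Fin m → Fin (m + 1)) (a : Fin (m + 1)) :
    leviCivita (m + 1) (Fin.snoc L a : Fin (m + 1) → Fin (m + 1)) =
      (-1) ^ m * leviCivita (m + 1) (Fin.cons a L : Fin (m + 1) → Fin (m + 1)) := by
  have h : (Fin.cons a L : Fin (m + 1) → Fin (m + 1)) =
      (Fin.snoc L a : Fin (m + 1) → Fin (m + 1)) ∘ (finRotate (m + 1)).symm := by
    rw [Equiv.eq_comp_symm]
    ext k
    refine Fin.lastCases ?_ (fun k => ?_) k
    · simp
    · simp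
  rw [leviCivita, leviCivita, h]
  have e := Matrix.det_permute (finRotate (m + 1)).symm
    ((1 : Matrix (Fin (m + 1)) (Fin (m + 1)) ℂ).submatrix
    (Fin.snoc L a : Fin (m + 1) → Fin (m + 1)) id)
  rw [Matrix.submatrix_submatrix] at e
  rw [Function.id_comp] at e
  rw [e, Equiv.Perm.sign_symm, sign_finRotate]
  simp [← mul_assoc, ← mul_pow]

/-- Expanding along the first row turns each symbol into a signed minor of the identity without
column `a` or `b`, and Cauchy–Binet sums over `L`. If `a ≠ b`, the resulting matrix has a zero row,
namely the one indexed by the remaining column `b`. -/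
theorem sum_leviCivita_cons {m : ℕ} (a b : Fin (m + 1)) :
    ∑ L : Fin m → Fin (m + 1), leviCivita (m + 1) (Fin.cons a L : Fin (m + 1) → Fin (m + 1)) *
      leviCivita (m + 1) (Fin.cons b L : Fin (m + 1) → Fin (m + 1)) =
      if a = b then (m.factorial : ℂ) else 0 := by
  have h : ∀ (a : Fin (m + 1)) (L : Fin m → Fin (m + 1)),
      leviCivita (m + 1) (Fin.cons a L : Fin (m + 1) → Fin (m + 1)) = (-1) ^ (a : ℕ) *
        (((1 : Matrix (Fin (m + 1)) (Fin (m + 1)) ℂ).submatrix id a.succAbove).submatrix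
          L id).det := by
    intro a L
    rw [leviCivita, Matrix.det_succ_row_zero, Finset.sum_eq_single a]
    · rw [Matrix.submatrix_apply, Fin.cons_zero, id, Matrix.one_apply_eq, mul_one]
      rfl
    · intro j _ hj
      rw [Matrix.submatrix_apply, Fin.cons_zero, id, Matrix.one_apply_ne' hj, mul_zero, zero_mul]
    · simp
  have hs : ∀ n : ℕ, ((-1 : ℂ)) ^ n * (-1) ^ n = 1 := fun n => by
    rw [← mul_pow]
    simp
  calc _ = ((-1) ^ (a : ℕ) * (-1) ^ (b : ℕ)) * ∑ L : Fin m → Fin (m + 1),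
        (((1 : Matrix (Fin (m + 1)) (Fin (m + 1)) ℂ).submatrix id a.succAbove).submatrix
          L id).det *
        (((1 : Matrix (Fin (m + 1)) (Fin (m + 1)) ℂ).submatrix id b.succAbove).submatrix
          L id).det := by
        rw [Finset.mul_sum]
        refine Finset.sum_congr rfl fun L _ => ?_
        rw [h, h]
        ring
    _ = _ := by
        rw [sum_det_submatrix_mul_det_submatrix, Matrix.transpose_submatrix,
          Matrix.transpose_one]
        have e : ∀ i j, (submatrix (1 : Matrix (Fin (m + 1)) (Fin (m + 1)) ℂ) a.succAbove id *
            submatrix (1 : Matrix (Fin (m + 1)) (Fin (m + 1)) ℂ) id b.succAbove) i j =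
            if a.succAbove i = b.succAbove j then 1 else 0 := by
          intro i j
          simp [Matrix.mul_apply, Matrix.one_apply]
        split_ifs with hab
        · subst hab
          have : submatrix (1 : Matrix (Fin (m + 1)) (Fin (m + 1)) ℂ) a.succAbove id *
            submatrix (1 : Matrix (Fin (m + 1)) (Fin (m + 1)) ℂ) id a.succAbove = 1 := by
            ext i j
            rw [e]
            simp [Matrix.one_apply]
          rw [this, Matrix.det_one, hs]
          ring
        · obtain ⟨i, hi⟩ := Fin.exists_succAbove_eq (Ne.symm hab)
          rw [Matrix.det_eq_zero_of_row_eq_zero i fun j => ?_, mul_zero, mul_zero]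
          rw [e, hi, if_neg]
          exact (Fin.succAbove_ne b j).symm

/-- The conjugate equation of the totally antisymmetric tensor. -/
theorem contract_antisymTensor (hd : 1 ≤ d) :
    castArrow (H := TMat d) rfl (Nat.zero_add 1)
      (tensor (antisymTensor d)ᴴ (1 : TMat d 1 1)) *
    castArrow (H := TMat d) rfl (Nat.add_comm 1 d)
      (tensor (1 : TMat d 1 1) (antisymTensor d)) =
    ((-1 : ℂ) ^ (d - 1) * (d : ℂ)⁻¹) • (1 : TMat d 1 1) := by
  obtain ⟨m, rfl⟩ : ∃ m, d = m + 1 := ⟨d - 1, by omega⟩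
  ext I J
  have h1 : ∀ A B : Fin 1 → Fin (m + 1), (1 : TMat (m + 1) 1 1) A B =
      if A 0 = B 0 then 1 else 0 := fun A B => by
    rw [Matrix.one_apply]
    refine if_congr ⟨fun h => congrFun h 0, fun h => ?_⟩ rfl rfl
    ext k
    rw [Subsingleton.elim k 0, h]
  -- The intermediate multi-index in the power `d + 1` is written `(x, L, y)`: `S*` pairs with `(x,
  -- L)` and S supplies `(L, y)`. The two identity factors force `x = J 0` and `y = I 0`, leaving a
  -- sum over `L` equal to `(-1)^m m!/(m+1)!` on the diagonal.
  have hc : ∀ (x y : Fin (m + 1)) (L : Fin m → Fin (m + 1)),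
      ((Fin.cons x (Fin.snoc L y : Fin (m + 1) → Fin (m + 1)) : Fin (m + 1 + 1) → Fin (m + 1)) ∘
        Fin.cast rfl) ∘ Fin.castAdd 1 = (Fin.cons x L : Fin (m + 1) → Fin (m + 1)) := by
    intro x y L
    ext k
    refine Fin.cases ?_ (fun k => ?_) k
    · rfl
    · have : (Fin.castAdd 1 k.succ) = k.castSucc.succ := rfl
      simp [this]
  have hn : ∀ (x y : Fin (m + 1)) (L : Fin m → Fin (m + 1)),
      ((Fin.cons x (Fin.snoc L y : Fin (m + 1) → Fin (m + 1)) : Fin (m + 1 + 1) → Fin (m + 1)) ∘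
        Fin.cast (Nat.add_comm 1 (m + 1))) ∘ Fin.natAdd 1 =
          (Fin.snoc L y : Fin (m + 1) → Fin (m + 1)) := by
    intro x y L
    ext k
    have : Fin.cast (Nat.add_comm 1 (m + 1)) (Fin.natAdd 1 k) = k.succ := by
      ext
      simp
    simp [this]
  have hl : Fin.natAdd (m + 1) (0 : Fin 1) = (Fin.last m).succ := rfl
  have hz : Fin.cast (Nat.add_comm 1 (m + 1)) (Fin.castAdd (m + 1) (0 : Fin 1)) = 0 := rfl
  have hs : ((-1 : ℂ)) ^ m * (-1) ^ m = 1 := by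
    rw [← mul_pow]
    simp
  rw [Matrix.mul_apply, ← (Fin.consEquiv fun _ : Fin (m + 1 + 1) => Fin (m + 1)).sum_comp,
    Fintype.sum_prod_type]
  simp_rw [← (Fin.snocEquiv fun _ : Fin (m + 1) => Fin (m + 1)).sum_comp, Fintype.sum_prod_type]
  simp only [castArrow_apply, tensor_apply, Fin.consEquiv, Fin.snocEquiv, Equiv.coe_fn_mk, hc, hn,
    h1, Matrix.conjTranspose_apply, star_antisymTensor]
  simp only [Function.comp_apply, hl, hz, Fin.cast_eq_self, Fin.cons_succ, Fin.snoc_last,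
    Fin.cons_zero]
  have hI : I (Fin.natAdd 0 (0 : Fin 1)) = I 0 := rfl
  have hJ : J (Fin.castAdd 0 (0 : Fin 1)) = J 0 := rfl
  have hm : ((m + 1 : ℕ) : ℂ) ≠ 0 := Nat.cast_ne_zero.mpr m.succ_ne_zero
  have hf : (m.factorial : ℂ) ≠ 0 := Nat.cast_ne_zero.mpr m.factorial_ne_zero
  rw [hI, hJ, Matrix.smul_apply, smul_eq_mul, h1 I J, Nat.add_sub_cancel,
    Finset.sum_eq_single (J 0) (fun x _ hx => by simp [hx]) (by simp),
    Finset.sum_eq_single (I 0) (fun x _ hx => by simp [hx.symm]) (by simp)]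
  have e : ∀ L : Fin m → Fin (m + 1), leviCivita (m + 1) (Fin.cons (J 0) L : Fin (m + 1) → _) *
      leviCivita (m + 1) (Fin.snoc L (I 0) : Fin (m + 1) → _) = (-1) ^ m *
        (leviCivita (m + 1) (Fin.cons (I 0) L : Fin (m + 1) → _) *
          leviCivita (m + 1) (Fin.cons (J 0) L : Fin (m + 1) → _)) := fun L => by
    rw [leviCivita_snoc]
    ring
  calc _ = ((m + 1).factorial : ℂ)⁻¹ * ∑ L : Fin m → Fin (m + 1),
        leviCivita (m + 1) (Fin.cons (J 0) L : Fin (m + 1) → _) *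
          leviCivita (m + 1) (Fin.snoc L (I 0) : Fin (m + 1) → _) := by
        rw [← inv_sqrt_factorial_mul_self, Finset.mul_sum]
        refine Finset.sum_congr rfl fun L _ => ?_
        simp only [antisymTensor, Matrix.of_apply, if_true]
        ring
    _ = _ := by
        simp only [e, ← Finset.mul_sum]
        rw [sum_leviCivita_cons, Nat.factorial_succ, Nat.cast_mul]
        split_ifs
        · field_simp
        · simp

end TMat

open scoped Matrix

/-! ### Permutation operators on tensor powers of `ℂ^d`. -/

/-- The recursive decomposition of a permutation which defines `perm`. -/
theorem TMat.perm_decomp {d n : ℕ} (p : Equiv.Perm (Fin (n + 1))) :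
    castArrow (H := TMat d) (r := 1 + (p 0 : ℕ) + (n - p 0)) (s := (p 0 : ℕ) + 1 + (n - p 0))
        (by have := (p 0).isLt; omega) (by have := (p 0).isLt; omega)
        (TMat.tensor (TMat.flip d 1 (p 0)) (1 : TMat d (n - p 0) (n - p 0))) *
      castArrow (H := TMat d) (Nat.add_comm 1 n) (Nat.add_comm 1 n)
        (TMat.tensor (1 : TMat d 1 1) (TMat.pm d
          (Equiv.Perm.decomposeFin ((p 0).cycleRange * p)).2.symm)) = TMat.pm d p.symm := by
  obtain ⟨q, hq⟩ : ∃ q, q = (Equiv.Perm.decomposeFin ((p 0).cycleRange * p)) := ⟨_, rfl⟩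
  have hs : Equiv.Perm.decomposeFin.symm q = (p 0).cycleRange * p := by
    rw [hq, Equiv.symm_apply_apply]
  -- The cycle takes `p 0` back to 0, so the product fixes 0 and amounts to a permutation of the
  -- other `n` points.
  have h0 : q.1 = 0 := by
    have h := congrArg (fun e : Equiv.Perm (Fin (n + 1)) => e 0) hs
    rw [show q = (q.1, q.2) from rfl] at h
    simpa only [Equiv.Perm.decomposeFin_symm_apply_zero, Equiv.Perm.mul_apply,
      Fin.cycleRange_self] using h
  rw [show q = (0, q.2) from Prod.ext h0 rfl] at hs
  have hp : p.symm = ((p 0).cycleRange).trans (Equiv.Perm.decomposeFin.symm (0, q.2)).symm := by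
    rw [hs]
    ext k
    simp [Equiv.Perm.mul_def]
  rw [← hq, TMat.one_eq, TMat.one_eq, TMat.flip_eq, TMat.tensor_pm, TMat.tensor_pm,
    TMat.castArrow_pm, TMat.castArrow_pm, TMat.pm_mul_pm, hp]
  congr 2
  · ext k
    have := k.isLt
    have := (p 0).isLt
    simp only [Equiv.trans_apply, finCongr_apply, Fin.val_cast, TMat.finSumCongr_val,
      TMat.finAddFlip_val, Equiv.refl_apply]
    -- The cycle shifts places before `p 0` up by one, sends `p 0` to 0 and fixes later places; the
    -- flip of one factor past `p 0` factors does the same.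
    rcases lt_trichotomy k (p 0) with h | h | h
    · rw [Fin.coe_cycleRange_of_lt h]
      rw [Fin.lt_def] at h
      split_ifs <;> omega
    · rw [Fin.cycleRange_of_eq h]
      rw [Fin.ext_iff] at h
      split_ifs <;> simp <;> omega
    · rw [Fin.cycleRange_of_gt h]
      rw [Fin.lt_def] at h
      split_ifs <;> omega
  · rw [Equiv.eq_symm_iff_trans_eq_refl]
    ext k
    rw [Equiv.trans_apply, Equiv.refl_apply]
    refine Fin.cases ?_ (fun k => ?_) k
    · have : ((finCongr (Nat.add_comm 1 n).symm).trans ((TMat.finSumCongr (Equiv.refl (Fin 1))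
          q.2.symm).trans (finCongr (Nat.add_comm 1 n)))) 0 = 0 := by
        ext
        simp [-Fin.val_eq_zero_iff, TMat.finSumCongr_val]
      rw [this, Equiv.Perm.decomposeFin_symm_apply_zero]
    · have : ((finCongr (Nat.add_comm 1 n).symm).trans ((TMat.finSumCongr (Equiv.refl (Fin 1))
          q.2.symm).trans (finCongr (Nat.add_comm 1 n)))) k.succ = (q.2.symm k).succ := by
        ext
        simp [TMat.finSumCongr_val, Nat.add_comm]
      rw [this, Equiv.Perm.decomposeFin_symm_apply_succ, Equiv.apply_symm_apply,
        Equiv.swap_self, Equiv.refl_apply]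

/-! ### The action of `(ι, ι) = C(X)` on arrows. -/

namespace SymTensorCStarCat

variable {T : SymTensorCStarCat.{u}}

/-- Composition with a fixed arrow on the left is continuous. -/
theorem continuous_comp_left {r s t : ℕ} (b : T.Hom s t) :
    Continuous fun a : T.Hom r s => T.comp b a :=
  ((T.comp b).mkContinuous ‖b‖ fun a => T.norm_comp_le b a).continuous

/-- Composition with a fixed arrow on the right is continuous. -/
theorem continuous_comp_right {r s t : ℕ} (a : T.Hom r s) :
    Continuous fun b : T.Hom s t => T.comp b a :=
  ((T.comp.flip a).mkContinuous ‖a‖ fun b =>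
    (T.norm_comp_le b a).trans_eq (mul_comm _ _)).continuous

theorem eq_zero_of_adj_comp_self {r s : ℕ} {a : T.Hom r s} (h : T.comp (T.adj a) a = 0) :
    a = 0 := by
  have := T.norm_adj_comp_self a
  rw [h, norm_zero] at this
  exact norm_eq_zero.mp (pow_eq_zero_iff two_ne_zero |>.mp this.symm)

/-- By the interchange law the scalar action is right composition with a fixed arrow, so its
continuity and its compatibility with left composition come for free. -/
theorem scal_eq_comp {r s : ℕ} (f : T.Hom 0 0) (t : T.Hom r s) :
    T.scal f t = T.comp t (T.tensor (T.one r) f) := by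
  have h := T.tensor_comp t (T.one r) (T.one 0) f
  rw [T.comp_one, T.one_comp, T.tensor_one_zero] at h
  exact h

theorem continuous_scal {r s : ℕ} (f : T.Hom 0 0) :
    Continuous fun t : T.Hom r s => T.scal f t := by
  simp only [scal_eq_comp]
  exact continuous_comp_right _

theorem comp_scal {r s t : ℕ} (f : T.Hom 0 0) (b : T.Hom s t) (a : T.Hom r s) :
    T.comp b (T.scal f a) = T.scal f (T.comp b a) := by
  rw [scal_eq_comp, scal_eq_comp, T.comp_assoc]

theorem scal_add {r s : ℕ} (f : T.Hom 0 0) (a b : T.Hom r s) :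
    T.scal f (a + b) = T.scal f a + T.scal f b := by
  rw [scal, map_add, LinearMap.add_apply]
  rfl

theorem scal_smul {r s : ℕ} (f : T.Hom 0 0) (c : ℂ) (a : T.Hom r s) :
    T.scal f (c • a) = c • T.scal f a := by
  rw [scal, map_smul, LinearMap.smul_apply]
  rfl

theorem scal_zero {r s : ℕ} (f : T.Hom 0 0) : T.scal f (0 : T.Hom r s) = 0 := by
  rw [scal, map_zero, LinearMap.zero_apply]

theorem scal_sum {r s n : ℕ} (f : Fin n → T.Hom 0 0) (a : T.Hom r s) :
    T.scal (∑ i, f i) a = ∑ i, T.scal (f i) a :=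
  map_sum (T.tensor a) f Finset.univ

theorem one_scal {r s : ℕ} (a : T.Hom r s) : T.scal (T.one 0) a = a := T.tensor_one_zero a

theorem scal_scal {r s : ℕ} (f g : T.Hom 0 0) (a : T.Hom r s) :
    T.scal f (T.scal g a) = T.scal (T.comp g f) a := by
  have h := T.tensor_comp (T.one r) (T.one r) g f
  rw [T.comp_one] at h
  rw [scal_eq_comp, scal_eq_comp, scal_eq_comp, T.comp_assoc, h]

section Functions

/-- The arrow in `(ι, ι)` given by a continuous function on the spectrum. -/
noncomputable def ofFun (T : SymTensorCStarCat.{u}) (f : C(T.Spec, ℂ)) : T.Hom 0 0 :=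
  (gelfandStarTransform T.Scalars).symm f

theorem eval_eq (x : T.Spec) (f : T.Hom 0 0) :
    T.eval x f = gelfandStarTransform T.Scalars f x := rfl

theorem eval_ofFun (x : T.Spec) (f : C(T.Spec, ℂ)) : T.eval x (T.ofFun f) = f x := by
  rw [eval_eq, ofFun, StarAlgEquiv.apply_symm_apply]

theorem ext_eval {f g : T.Hom 0 0} (h : ∀ x, T.eval x f = T.eval x g) : f = g :=
  (gelfandStarTransform T.Scalars).injective (ContinuousMap.ext h)

theorem eval_comp (x : T.Spec) (f g : T.Hom 0 0) :
    T.eval x (T.comp f g) = T.eval x f * T.eval x g :=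
  map_mul x (show T.Scalars from f) (show T.Scalars from g)

theorem eval_one (x : T.Spec) : T.eval x (T.one 0) = 1 := map_one x

theorem eval_zero (x : T.Spec) : T.eval x 0 = 0 := map_zero x

theorem eval_sum {n : ℕ} (x : T.Spec) (f : Fin n → T.Hom 0 0) :
    T.eval x (∑ i, f i) = ∑ i, T.eval x (f i) := map_sum x f Finset.univ

end Functions

/-- A function which vanishes off `W` annihilates the kernel of the restriction to `W`. -/
theorem scal_eq_zero_of_mem_vanishing {W : Set T.Spec} {r s : ℕ} {t : T.Hom r s}
    (ht : t ∈ T.vanishing W r s) {k : T.Hom 0 0} (hk : ∀ x ∉ W, T.eval x k = 0) :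
    T.scal k t = 0 := by
  have hcl : IsClosed {t : T.Hom r s | T.scal k t = 0} :=
    isClosed_singleton.preimage (continuous_scal k)
  refine closure_minimal (fun a ha => ?_) hcl ht
  refine Submodule.span_induction (p := fun a _ => T.scal k a = 0) ?_ (scal_zero k) ?_ ?_ ha
  · rintro _ ⟨f, t, hf, rfl⟩
    have : T.comp f k = 0 := ext_eval fun x => by
      rw [eval_comp, eval_zero]
      by_cases hx : x ∈ W
      · rw [hf x hx, zero_mul]
      · rw [hk x hx, mul_zero]
    rw [scal_scal, this]
    exact map_zero (T.tensor t)
  · intro a b _ _ ha hb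
    rw [scal_add, ha, hb, add_zero]
  · intro c a _ ha
    rw [scal_smul, ha, smul_zero]

end SymTensorCStarCat

/-! ### Charts at a point, and coefficients along the antisymmetric tensor. -/

namespace TMat

variable {d : ℕ}

theorem smul_tensor {r s r' s' : ℕ} (c : ℂ) (a : TMat d r s) (b : TMat d r' s') :
    tensor (c • a) b = c • tensor a b := by
  ext I J
  simp [tensor_apply, mul_assoc]

theorem tensor_smul {r s r' s' : ℕ} (c : ℂ) (a : TMat d r s) (b : TMat d r' s') :
    tensor a (c • b) = c • tensor a b := by
  ext I J
  simp [tensor_apply, mul_left_comm]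

theorem castArrow_smul {r s r' s' : ℕ} (hr : r = r') (hs : s = s') (c : ℂ) (a : TMat d r s) :
    castArrow (H := TMat d) hr hs (c • a) = c • castArrow (H := TMat d) hr hs a := by
  subst hr hs
  rfl

theorem eq_smul_one (a : TMat d 0 0) : a = a default default • (1 : TMat d 0 0) := by
  ext I J
  rw [Subsingleton.elim I default, Subsingleton.elim J default]
  simp

theorem tpow_zero (u : Matrix (Fin d) (Fin d) ℂ) : tpow u 0 = 1 := by
  ext I J
  rw [Subsingleton.elim I J]
  simp [tpow]

/-- The coefficient of a vector along the totally antisymmetric tensor. -/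
noncomputable def antisymCoeff (d : ℕ) : TMat d 0 d →ₗ[ℂ] ℂ where
  toFun a := ((antisymTensor d)ᴴ * a) default default
  map_add' a b := by rw [Matrix.mul_add, Matrix.add_apply]
  map_smul' c a := by rw [Matrix.mul_smul, Matrix.smul_apply]; rfl

theorem antisymTensor_mul_conjTranspose_mul (a : TMat d 0 d) :
    antisymTensor d * (antisymTensor d)ᴴ * a = antisymCoeff d a • antisymTensor d := by
  rw [Matrix.mul_assoc, eq_smul_one ((antisymTensor d)ᴴ * a), Matrix.mul_smul, Matrix.mul_one]
  rfl

theorem antisymCoeff_antisymTensor : antisymCoeff d (antisymTensor d) = 1 := by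
  change ((antisymTensor d)ᴴ * antisymTensor d) default default = 1
  rw [conjTranspose_mul_antisymTensor, Matrix.one_apply_eq]

theorem antisymCoeff_smul_antisymTensor (c : ℂ) : antisymCoeff d (c • antisymTensor d) = c := by
  rw [map_smul, antisymCoeff_antisymTensor, smul_eq_mul, mul_one]

end TMat

namespace SymTensorCStarCat

variable {T : SymTensorCStarCat.{u}} {d : ℕ} {G : Subgroup (Matrix.unitaryGroup (Fin d) ℂ)}

namespace LocalChart

variable {W : Set T.Spec} (π : T.LocalChart (dualCategory G) W) (x : W)

/-- The evaluation of a local chart at a point, with values in linear maps between tensor powers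
of `ℂ^d`. -/
noncomputable def fibre {r s : ℕ} : T.Hom r s →ₗ[ℂ] TMat d r s where
  toFun t := (π.map t x).1
  map_add' a b := by rw [map_add]; rfl
  map_smul' c a := by rw [map_smul]; rfl

theorem fibre_one (r : ℕ) : π.fibre x (T.one r) = 1 := congrArg Subtype.val (π.map_one r x)

theorem fibre_comp {r s t : ℕ} (b : T.Hom s t) (a : T.Hom r s) :
    π.fibre x (T.comp b a) = π.fibre x b * π.fibre x a :=
  congrArg Subtype.val (π.map_comp b a x)

theorem fibre_adj {r s : ℕ} (a : T.Hom r s) : π.fibre x (T.adj a) = (π.fibre x a)ᴴ :=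
  congrArg Subtype.val (π.map_adj a x)

theorem fibre_tensor {r s r' s' : ℕ} (a : T.Hom r s) (b : T.Hom r' s') :
    π.fibre x (T.tensor a b) = TMat.tensor (π.fibre x a) (π.fibre x b) :=
  congrArg Subtype.val (π.map_tensor a b x)

theorem fibre_sym (r s : ℕ) : π.fibre x (T.sym r s) = TMat.flip d r s :=
  congrArg Subtype.val (π.map_sym r s x)

theorem fibre_scal {r s : ℕ} (f : T.Hom 0 0) (a : T.Hom r s) :
    π.fibre x (T.scal f a) = T.eval x f • π.fibre x a :=
  congrArg Subtype.val (π.map_scal f a x)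

theorem fibre_castArrow {r s r' s' : ℕ} (hr : r = r') (hs : s = s') (a : T.Hom r s) :
    π.fibre x (castArrow hr hs a) = castArrow (H := TMat d) hr hs (π.fibre x a) := by
  subst hr hs
  rfl

theorem fibre_scalar (f : T.Hom 0 0) : π.fibre x f = T.eval x f • (1 : TMat d 0 0) := by
  have h : T.scal f (T.one 0) = f := T.one_tensor f
  rw [← fibre_one π x 0, ← fibre_scal, h]

/-- The inverse appears because `ε(p)` moves the factor at place `k` to place `p k`, whereas `pm`
acts on multi-indices by precomposition. The recursion defining `perm` is matched by
`TMat.perm_decomp`. -/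
theorem fibre_perm (n : ℕ) (p : Equiv.Perm (Fin n)) :
    π.fibre x (T.perm n p) = TMat.pm d p.symm := by
  induction n with
  | zero =>
    rw [perm, fibre_one, TMat.one_eq]
    congr 1
    ext k
    exact k.elim0
  | succ n ih =>
    rw [perm, fibre_comp, fibre_castArrow, fibre_castArrow, fibre_tensor, fibre_tensor, fibre_sym,
      fibre_one, fibre_one, ih, TMat.perm_decomp]

theorem fibre_antisym :
    π.fibre x (T.antisym d) = TMat.antisymTensor d * (TMat.antisymTensor d)ᴴ := by
  rw [antisym, map_smul, map_sum, TMat.antisymTensor_mul_conjTranspose]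
  simp only [map_smul, fibre_perm]

theorem fibre_scalar_tensor {r s : ℕ} (f : T.Hom 0 0) (a : T.Hom r s) :
    π.fibre x (castArrow (Nat.zero_add r) (Nat.zero_add s) (T.tensor f a)) =
      T.eval x f • π.fibre x a := by
  rw [fibre_castArrow, fibre_tensor, fibre_scalar, TMat.smul_tensor, TMat.castArrow_smul,
    TMat.one_tensor]

/-- The coefficient of an arrow along the totally antisymmetric tensor, in the chart `π`. -/
noncomputable def coeff : T.Hom 0 d →ₗ[ℂ] ℂ := TMat.antisymCoeff d ∘ₗ π.fibre x

theorem fibre_antisym_comp (v : T.Hom 0 d) :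
    π.fibre x (T.comp (T.antisym d) v) = π.coeff x v • TMat.antisymTensor d := by
  rw [fibre_comp, fibre_antisym, TMat.antisymTensor_mul_conjTranspose_mul]
  rfl

/-- The coefficient is a fixed linear functional on a finite-dimensional arrow space, applied to a
continuous section. -/
theorem continuous_coeff (v : T.Hom 0 d) : Continuous fun x => π.coeff x v := by
  let L : (dualCategory G).Hom 0 d →ₗ[ℂ] ℂ :=
    TMat.antisymCoeff d ∘ₗ (equivariantMaps G 0 d).subtype
  have : FiniteDimensional ℂ ((dualCategory G).Hom 0 d) :=
    inferInstanceAs (FiniteDimensional ℂ (equivariantMaps G 0 d))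
  exact L.continuous_of_finiteDimensional.comp (π.map v).continuous

theorem fibre_eq_coeff_smul {v : T.Hom 0 d} (hv : T.comp (T.antisym d) v = v) :
    π.fibre x v = π.coeff x v • TMat.antisymTensor d := by
  rw [← fibre_antisym_comp, hv]

theorem coeff_of_fibre_eq {v : T.Hom 0 d} {c : ℂ}
    (h : π.fibre x v = c • TMat.antisymTensor d) : π.coeff x v = c := by
  rw [coeff, LinearMap.comp_apply, h, TMat.antisymCoeff_smul_antisymTensor]

theorem fibre_comp_adj {v w : T.Hom 0 d} {a b : ℂ} (hv : π.fibre x v = a • TMat.antisymTensor d)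
    (hw : π.fibre x w = b • TMat.antisymTensor d) :
    π.fibre x (T.comp w (T.adj v)) = (star a * b) • π.fibre x (T.antisym d) := by
  rw [fibre_comp, fibre_adj, hv, hw, Matrix.conjTranspose_smul, Matrix.smul_mul, Matrix.mul_smul,
    smul_smul, fibre_antisym, mul_comm]

theorem eval_adj_comp {v w : T.Hom 0 d} {a b : ℂ} (hv : π.fibre x v = a • TMat.antisymTensor d)
    (hw : π.fibre x w = b • TMat.antisymTensor d) :
    T.eval x (T.comp (T.adj v) w) = star a * b := by
  have h := π.fibre_scalar x (T.comp (T.adj v) w)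
  rw [fibre_comp, fibre_adj, hv, hw, Matrix.conjTranspose_smul, Matrix.smul_mul, Matrix.mul_smul,
    smul_smul, TMat.conjTranspose_mul_antisymTensor] at h
  have h' := congrFun (congrFun h default) default
  simpa using h'.symm

theorem fibre_contract (hd : 1 ≤ d) {v w : T.Hom 0 d} {a b : ℂ}
    (hv : π.fibre x v = a • TMat.antisymTensor d) (hw : π.fibre x w = b • TMat.antisymTensor d) :
    π.fibre x (T.contract v w) =
      (star a * b) • (((-1 : ℂ) ^ (d - 1) * (d : ℂ)⁻¹) • (1 : TMat d 1 1)) := by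
  have h1 := π.fibre_tensor x (T.adj v) (T.one 1)
  rw [fibre_adj, fibre_one, hv, Matrix.conjTranspose_smul, TMat.smul_tensor] at h1
  have h2 := π.fibre_tensor x (T.one 1) w
  rw [fibre_one, hw, TMat.tensor_smul] at h2
  rw [← TMat.contract_antisymTensor hd, contract, fibre_comp, fibre_castArrow, fibre_castArrow, h1]
  refine (congrArg (fun M => _ * castArrow (H := TMat d) _ _ M) h2).trans ?_
  rw [TMat.castArrow_smul, TMat.castArrow_smul, Matrix.smul_mul, Matrix.mul_smul, smul_smul]

end LocalChart

/-! ### Atlases, partitions of unity and local frames. -/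

/-- An atlas of local charts with values in `Ĝ` whose transition maps are given by `y`. -/
structure DualAtlas (T : SymTensorCStarCat.{u}) (G : Subgroup (Matrix.unitaryGroup (Fin d) ℂ))
    (y : CechOneCocycle T.Spec (QGroup G)) where
  W : Fin y.n → Set T.Spec
  subset : ∀ i, y.U i ⊆ W i
  chart : ∀ i, T.LocalChart (dualCategory G) (W i)
  transition : ∀ (i j : Fin y.n) (x : T.Spec) (hi : x ∈ y.U i) (hj : x ∈ y.U j) (u : NGroup G),
    (QuotientGroup.mk u : QGroup G) = y.g i j x → ∀ (r s : ℕ) (t : T.Hom r s),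
      (chart i).fibre ⟨x, subset i hi⟩ t =
        TMat.tpow u.1.1 s * (chart j).fibre ⟨x, subset j hj⟩ t * (TMat.tpow u.1.1 r)ᴴ

/-- A continuous function on the spectrum defined by a partition of unity and local functions. -/
theorem exists_scalar_eq_mul {n : ℕ} {U : Fin n → Set T.Spec} (hU : ∀ i, IsOpen (U i))
    {h : PartitionOfUnity (Fin n) T.Spec Set.univ} (hh : h.IsSubordinate U) (i : Fin n)
    {s : T.Spec → ℂ} (hs : ContinuousOn s (U i)) :
    ∃ f : T.Hom 0 0, ∀ x, T.eval x f = h i x * s x := by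
  have hc : Continuous fun x => h i x • s x :=
    h.continuous_smul fun x hx => hs.continuousAt ((hU i).mem_nhds (hh i hx))
  exact ⟨T.ofFun ⟨_, hc⟩, fun x => by rw [eval_ofFun]; exact Complex.real_smul⟩

/-- A partition of unity by squares of scalars. -/
theorem exists_sum_mul_self_eq_one {n : ℕ} {U : Fin n → Set T.Spec} (hU : ∀ i, IsOpen (U i))
    (hcov : ∀ x, ∃ i, x ∈ U i) :
    ∃ k : Fin n → T.Hom 0 0, (∀ i, ∀ x ∉ U i, T.eval x (k i) = 0) ∧
      (∀ i x, star (T.eval x (k i)) = T.eval x (k i)) ∧ ∑ i, T.comp (k i) (k i) = T.one 0 := by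
  obtain ⟨h, hh⟩ := PartitionOfUnity.exists_isSubordinate (isClosed_univ (X := T.Spec)) U hU
    (fun x _ => Set.mem_iUnion.mpr (hcov x))
  -- Square roots of a partition of unity: local unit frames multiplied by them form a Parseval
  -- frame.
  have hk : ∀ i x, T.eval x (T.ofFun ⟨fun x => ((Real.sqrt (h i x) : ℝ) : ℂ),
      Complex.continuous_ofReal.comp (h i).continuous.sqrt⟩) = ((Real.sqrt (h i x) : ℝ) : ℂ) :=
    fun i x => eval_ofFun x _
  refine ⟨fun i => T.ofFun ⟨fun x => ((Real.sqrt (h i x) : ℝ) : ℂ),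
      Complex.continuous_ofReal.comp (h i).continuous.sqrt⟩, fun i x hx => ?_, fun i x => ?_, ?_⟩
  · have : h i x = 0 := by
      by_contra h0
      exact hx (hh i (subset_tsupport _ h0))
    rw [hk, this, Real.sqrt_zero, Complex.ofReal_zero]
  · rw [hk]
    exact Complex.conj_ofReal _
  · refine ext_eval fun x => ?_
    rw [eval_sum, eval_one]
    simp only [eval_comp, hk]
    have h1 := h.sum_eq_one (Set.mem_univ x)
    rw [finsum_eq_sum_of_fintype] at h1
    rw [← Complex.ofReal_one, ← h1, Complex.ofReal_sum]
    refine Finset.sum_congr rfl fun i _ => ?_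
    rw [← Complex.ofReal_mul, Real.mul_self_sqrt (h.nonneg i x)]

namespace DualAtlas

variable {y : CechOneCocycle T.Spec (QGroup G)}

/-- The evaluation of an arrow at a point in a chart of the atlas. -/
noncomputable abbrev fibre (A : DualAtlas T G y) (i : Fin y.n) (x : y.U i) {r s : ℕ} :
    T.Hom r s →ₗ[ℂ] TMat d r s :=
  (A.chart i).fibre ⟨x, A.subset i x.2⟩

/-- The coefficient of an arrow along the totally antisymmetric tensor in a chart of the atlas. -/
noncomputable abbrev coeff (A : DualAtlas T G y) (i : Fin y.n) (x : y.U i) : T.Hom 0 d →ₗ[ℂ] ℂ :=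
  (A.chart i).coeff ⟨x, A.subset i x.2⟩

/-- In `t = ∑ k_i k_i t` both factors `k_i` are needed. The inner one makes `k_i t` vanish on all of
`W i`, including the points outside `U i` where nothing is assumed on `t`, so `k_i t` is in the
kernel of the chart. The outer one vanishes off `W i` and annihilates that kernel. -/
theorem eq_zero (A : DualAtlas T G y) {r s : ℕ} {t : T.Hom r s}
    (h : ∀ i x, A.fibre i x t = 0) : t = 0 := by
  obtain ⟨k, hk0, -, hk1⟩ := exists_sum_mul_self_eq_one y.isOpen y.cover
  rw [← one_scal t, ← hk1, scal_sum]
  refine Finset.sum_eq_zero fun i _ => ?_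
  rw [← scal_scal]
  refine scal_eq_zero_of_mem_vanishing (W := A.W i) ?_ fun x hx =>
    hk0 i x fun hx' => hx (A.subset i hx')
  rw [← (A.chart i).ker_eq, LinearMap.mem_ker]
  ext x : 1
  rw [(A.chart i).map_scal]
  by_cases hx : (x : T.Spec) ∈ y.U i
  · have : (A.chart i).map t x = 0 := Subtype.ext (h i ⟨x, hx⟩)
    rw [this, smul_zero]
    rfl
  · rw [hk0 i x hx, zero_smul]
    rfl

theorem ext (A : DualAtlas T G y) {r s : ℕ} {t t' : T.Hom r s}
    (h : ∀ i x, A.fibre i x t = A.fibre i x t') : t = t' := by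
  refine sub_eq_zero.mp (A.eq_zero fun i x => ?_)
  rw [map_sub, h, sub_self]

theorem scalar_tensor (A : DualAtlas T G y) {r s : ℕ} (f : T.Hom 0 0) (t : T.Hom r s) :
    castArrow (Nat.zero_add r) (Nat.zero_add s) (T.tensor f t) = T.scal f t :=
  A.ext fun i x => by
    rw [LocalChart.fibre_scalar_tensor, LocalChart.fibre_scal]

/-- The source is `ι`, so conjugation by `u` reduces to left multiplication by `u^{⊗d}`, which acts
on S by `det u`. The result depends only on the class of `u` in `QG`. -/
theorem fibre_transition (A : DualAtlas T G y)
    (hG : ∀ g ∈ G, (g : Matrix (Fin d) (Fin d) ℂ).det = 1) {i j : Fin y.n}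
    {x : T.Spec} (hi : x ∈ y.U i) (hj : x ∈ y.U j) {v : T.Hom 0 d} {c : ℂ}
    (hv : A.fibre j ⟨x, hj⟩ v = c • TMat.antisymTensor d) :
    A.fibre i ⟨x, hi⟩ v = (detQ G hG (y.g i j x) * c : ℂ) • TMat.antisymTensor d := by
  obtain ⟨u, hu⟩ := QuotientGroup.mk_surjective (y.g i j x)
  have h := A.transition i j x hi hj u hu 0 d v
  rw [show (A.chart j).fibre ⟨x, A.subset j hj⟩ v = _ from hv, TMat.tpow_zero,
    Matrix.conjTranspose_one, Matrix.mul_one, Matrix.mul_smul, TMat.tpow_mul_antisymTensor,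
    smul_smul, mul_comm] at h
  rw [← hu]
  exact h

/-- A local frame: arrows which are totally antisymmetric and normalized in a chart. -/
theorem exists_frame (A : DualAtlas T G y)
    (hG : ∀ g ∈ G, (g : Matrix (Fin d) (Fin d) ℂ).det = 1) (i : Fin y.n) :
    ∃ v : T.Hom 0 d, ∀ x, A.fibre i x v = TMat.antisymTensor d := by
  -- `G ⊆ SU(d)` makes S an arrow of `Ĝ`, so the constant section S lies in the target of the chart
  -- and can be lifted.
  have hS : TMat.antisymTensor d ∈ equivariantMaps G 0 d := fun g hg => by
    rw [TMat.tpow_mul_antisymTensor, hG g hg, one_smul, TMat.tpow_zero, Matrix.mul_one]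
  obtain ⟨v, hv⟩ := (A.chart i).surjective 0 d (ContinuousMap.const _ ⟨_, hS⟩)
  exact ⟨v, fun x => congrArg Subtype.val (congrArg (fun φ => φ ⟨x, A.subset i x.2⟩) hv)⟩

/-- Arrows cut off to a chart domain from a local frame. -/
theorem fibre_scal_frame (A : DualAtlas T G y)
    (hG : ∀ g ∈ G, (g : Matrix (Fin d) (Fin d) ℂ).det = 1) {i : Fin y.n}
    {v : T.Hom 0 d} (hv : ∀ x, A.fibre i x v = TMat.antisymTensor d) {f : T.Hom 0 0}
    (hf : ∀ x ∉ y.U i, T.eval x f = 0) (j : Fin y.n) (x : y.U j) :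
    A.fibre j x (T.scal f v) =
      (T.eval x f * detQ G hG (y.g j i x) : ℂ) • TMat.antisymTensor d := by
  rw [LocalChart.fibre_scal]
  by_cases hx : (x : T.Spec) ∈ y.U i
  · rw [A.fibre_transition hG x.2 hx (c := 1) (by rw [hv, one_smul]), smul_smul, mul_one]
  · rw [hf x hx, zero_mul, zero_smul, zero_smul]

end DualAtlas

/-! ### Existence and uniqueness of the twisted special object. -/

/-- The totally antisymmetric arrows in `(ι, ρ^d)`. -/
noncomputable def antisymArrows (T : SymTensorCStarCat.{u}) (d : ℕ) : Submodule ℂ (T.Hom 0 d) :=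
  LinearMap.eqLocus (T.comp (T.antisym d)) LinearMap.id

theorem mem_antisymArrows {v : T.Hom 0 d} :
    v ∈ T.antisymArrows d ↔ T.comp (T.antisym d) v = v := Iff.rfl

namespace DualAtlas

variable {y : CechOneCocycle T.Spec (QGroup G)}

theorem mem_antisymArrows_iff (A : DualAtlas T G y) {v : T.Hom 0 d} : v ∈ T.antisymArrows d ↔
    ∀ i x, A.fibre i x v = A.coeff i x v • TMat.antisymTensor d := by
  refine ⟨fun hv i x => LocalChart.fibre_eq_coeff_smul _ _ hv, fun h => A.ext fun i x => ?_⟩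
  exact (LocalChart.fibre_antisym_comp _ _ v).trans (h i x).symm

theorem mem_antisymArrows_of_fibre (A : DualAtlas T G y) {v : T.Hom 0 d}
    (h : ∀ i x, ∃ c : ℂ, A.fibre i x v = c • TMat.antisymTensor d) : v ∈ T.antisymArrows d := by
  refine A.mem_antisymArrows_iff.mpr fun i x => ?_
  obtain ⟨c, hc⟩ := h i x
  rw [hc, LocalChart.coeff_of_fibre_eq _ _ hc]

/-- Finitely many totally antisymmetric arrows which form a Parseval frame. -/
theorem exists_parseval_frame (A : DualAtlas T G y)
    (hG : ∀ g ∈ G, (g : Matrix (Fin d) (Fin d) ℂ).det = 1) :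
    ∃ w : Fin y.n → T.Hom 0 d, (∀ i, w i ∈ T.antisymArrows d) ∧
      ∑ i, T.comp (w i) (T.adj (w i)) = T.antisym d ∧
      ∀ x, ∃ i, T.eval x (T.comp (T.adj (w i)) (w i)) ≠ 0 := by
  obtain ⟨k, hk0, hks, hk1⟩ := exists_sum_mul_self_eq_one y.isOpen y.cover
  choose v hv using A.exists_frame hG
  have hw := fun i => A.fibre_scal_frame hG (hv i) (hk0 i)
  -- The transition phases cancel in `w w*` and `w* w`, so both are governed by `k_i²` in every
  -- chart, whichever chart the frame came from.
  have hn : ∀ (z : Circle) (a : ℂ), star a = a → star (a * z) * (a * z) = a * a := fun z a ha => by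
    have : star (z : ℂ) * z = 1 := by
      rw [← starRingEnd_apply, ← Circle.coe_inv_eq_conj, ← Circle.coe_mul, inv_mul_cancel,
        Circle.coe_one]
    rw [star_mul', ha]
    linear_combination a * a * this
  refine ⟨fun i => T.scal (k i) (v i), fun i => A.mem_antisymArrows_of_fibre fun j x =>
    ⟨_, hw i j x⟩, A.ext fun j x => ?_, fun x => ?_⟩
  · rw [map_sum]
    have h1 := congrArg (T.eval x) hk1
    rw [eval_sum, eval_one] at h1
    simp only [LocalChart.fibre_comp_adj _ _ (hw _ j x) (hw _ j x), hn _ _ (hks _ _)]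
    simp only [eval_comp] at h1
    rw [← Finset.sum_smul, h1, one_smul]
  · by_contra! h
    have h1 := congrArg (T.eval x) hk1
    obtain ⟨j, hj⟩ := y.cover x
    rw [eval_sum, eval_one, Finset.sum_eq_zero] at h1
    · exact zero_ne_one h1
    · intro i _
      have h2 := h i
      rw [LocalChart.eval_adj_comp _ ⟨x, A.subset j hj⟩ (hw i j ⟨x, hj⟩) (hw i j ⟨x, hj⟩),
        hn _ _ (hks _ _)] at h2
      rw [eval_comp]
      exact h2

/-- In every chart, antisymmetric arrows are multiples of S, so the contraction axiom is the
conjugate equation for S extended sesquilinearly. In the span axiom, `w v*` equals `(v* w) P_d`;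
conversely the Parseval frame gives `f P_d = ∑ (f w_i) w_i*`. -/
theorem isTwistedSpecialObject (A : DualAtlas T G y) (hd : 1 ≤ d)
    (hG : ∀ g ∈ G, (g : Matrix (Fin d) (Fin d) ℂ).det = 1) :
    T.IsTwistedSpecialObject d (T.antisymArrows d) := by
  have hscal : ∀ v ∈ T.antisymArrows d, ∀ f, T.scal f v ∈ T.antisymArrows d := fun v hv f => by
    rw [mem_antisymArrows] at hv ⊢
    rw [comp_scal, hv]
  refine ⟨hd, isClosed_eq (continuous_comp_left _) continuous_id, fun v hv f =>
    ⟨A.scalar_tensor f v, hscal v hv f⟩, fun v hv w hw => A.ext fun i x => ?_, ?_⟩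
  · have hv' := LocalChart.fibre_eq_coeff_smul (A.chart i) ⟨x, A.subset i x.2⟩ hv
    have hw' := LocalChart.fibre_eq_coeff_smul (A.chart i) ⟨x, A.subset i x.2⟩ hw
    rw [LocalChart.fibre_contract _ _ hd hv' hw', map_smul, LocalChart.fibre_scalar_tensor,
      LocalChart.eval_adj_comp _ ⟨x, A.subset i x.2⟩ hv' hw', LocalChart.fibre_one, smul_comm]
  · ext t
    simp only [A.scalar_tensor]
    constructor
    · intro ht
      refine Submodule.span_induction ?_ ?_ ?_ ?_ ht
      · rintro _ ⟨v, hv, w, hw, rfl⟩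
        refine ⟨T.comp (T.adj v) w, A.ext fun i x => ?_⟩
        have hv' := LocalChart.fibre_eq_coeff_smul (A.chart i) ⟨x, A.subset i x.2⟩ hv
        have hw' := LocalChart.fibre_eq_coeff_smul (A.chart i) ⟨x, A.subset i x.2⟩ hw
        rw [LocalChart.fibre_comp_adj _ _ hv' hw', LocalChart.fibre_scal,
          LocalChart.eval_adj_comp _ ⟨x, A.subset i x.2⟩ hv' hw']
      · exact ⟨0, (map_zero (T.tensor (r' := 0) (s' := 0) (T.antisym d))).symm⟩
      · rintro _ _ _ _ ⟨f, rfl⟩ ⟨g, rfl⟩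
        exact ⟨f + g, (map_add (T.tensor (T.antisym d)) f g).symm⟩
      · rintro c _ _ ⟨f, rfl⟩
        exact ⟨c • f, (map_smul (T.tensor (T.antisym d)) c f).symm⟩
    · rintro ⟨f, rfl⟩
      obtain ⟨w, hw, hw1, -⟩ := A.exists_parseval_frame hG
      have : T.scal f (T.antisym d) = ∑ i, T.comp (T.scal f (w i)) (T.adj (w i)) := by
        refine A.ext fun i x => ?_
        simp only [← hw1, LocalChart.fibre_scal, map_sum, LocalChart.fibre_comp, Finset.smul_sum,
          Matrix.smul_mul]
      rw [this]
      exact Submodule.sum_mem _ fun i _ =>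
        Submodule.subset_span ⟨w i, hw i, _, hscal _ (hw i) f, rfl⟩

/-- Only the module and span axioms enter. For `v ∈ V`, `v v*` is a scalar multiple of `P_d`, and
the C*-identity yields `P_d v = v`. Conversely `P_d` lies in the span of the `b a*`, so an
antisymmetric `v = P_d v` is a combination of the arrows `b (a* v)`, which are scalar multiples of
elements of `V`. -/
theorem eq_antisymArrows (A : DualAtlas T G y) {V : Submodule ℂ (T.Hom 0 d)}
    (hV : T.IsTwistedSpecialObject d V) :
    V = T.antisymArrows d := by
  obtain ⟨-, -, hscal, -, hspan⟩ := hV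
  simp only [A.scalar_tensor] at hspan
  have hPP : T.comp (T.antisym d) (T.antisym d) = T.antisym d := A.ext fun i x => by
    rw [LocalChart.fibre_comp, LocalChart.fibre_antisym, Matrix.mul_assoc, ← Matrix.mul_assoc _ᴴ,
      TMat.conjTranspose_mul_antisymTensor, Matrix.one_mul]
  refine le_antisymm (fun v hv => ?_) (fun v hv => ?_)
  · have h1 : T.comp v (T.adj v) ∈ (Submodule.span ℂ {t : T.Hom d d | ∃ v ∈ V, ∃ w ∈ V,
        t = T.comp w (T.adj v)} : Set (T.Hom d d)) :=
      Submodule.subset_span ⟨v, hv, v, hv, rfl⟩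
    rw [hspan] at h1
    obtain ⟨f, hf⟩ := h1
    have h2 : T.comp (T.antisym d) (T.comp v (T.adj v)) = T.comp v (T.adj v) := by
      rw [hf, comp_scal, hPP]
    rw [mem_antisymArrows, ← sub_eq_zero, ← T.adj_adj (_ - v)]
    have h3 : T.adj (T.comp (T.antisym d) v - v) = 0 := by
      have h4 : T.comp (T.comp (T.antisym d) v - v) (T.adj v) = 0 := by
        rw [map_sub, LinearMap.sub_apply, T.comp_assoc, h2, sub_self]
      -- With `X = P_d v - v` the quantity to kill is `X X* = (X v*) P_d* - X v*`, and `X v* = 0` by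
      -- `h4`.
      refine eq_zero_of_adj_comp_self ?_
      rw [T.adj_adj, map_sub T.adj, T.adj_comp, map_sub, ← T.comp_assoc, h4, zero_comp, sub_self]
    rw [h3, map_zero]
  · have h1 : T.antisym d ∈ (Submodule.span ℂ {t : T.Hom d d | ∃ v ∈ V, ∃ w ∈ V,
        t = T.comp w (T.adj v)} : Set (T.Hom d d)) := by
      rw [hspan]
      exact ⟨T.one 0, (one_scal _).symm⟩
    rw [← mem_antisymArrows.mp hv]
    refine Submodule.span_induction (p := fun t _ => T.comp t v ∈ V) ?_ ?_ ?_ ?_ h1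
    · rintro _ ⟨a, ha, b, hb, rfl⟩
      rw [T.comp_assoc]
      have h2 : T.scal (T.comp (T.adj a) v) b ∈ V := (hscal b hb _).2
      have h3 : T.tensor (T.one 0) (T.comp (T.adj a) v) = T.comp (T.adj a) v :=
        T.one_tensor (T.comp (T.adj a) v)
      rw [scal_eq_comp, h3] at h2
      exact h2
    · rw [zero_comp]
      exact V.zero_mem
    · intro a b _ _ ha hb
      rw [add_comp]
      exact V.add_mem ha hb
    · intro c a _ ha
      rw [map_smul, LinearMap.smul_apply]
      exact V.smul_mem c ha

end DualAtlas

end SymTensorCStarCat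

/-! ### Section modules, line bundles and the Chern class. -/

namespace SymTensorCStarCat

variable {T : SymTensorCStarCat.{u}} {d : ℕ} {G : Subgroup (Matrix.unitaryGroup (Fin d) ℂ)}

/-- Hermitian line bundles with the same module of continuous sections have equivalent transition
maps. -/
theorem IsSectionModule.equivalent {V : Submodule ℂ (T.Hom 0 d)}
    (hV : ∀ x, ∃ v ∈ V, T.eval x (T.comp (T.adj v) v) ≠ 0) {g g' : CechOneCocycle T.Spec Circle}
    (hg : T.IsSectionModule V g) (hg' : T.IsSectionModule V g') :
    CechOneCocycle.Equivalent g g' := by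
  obtain ⟨Φ, -, hs, -, hm⟩ := hg
  obtain ⟨Φ', -, hs', -, hm'⟩ := hg'
  choose v hvV hv using hV
  let e : T.Spec → V := fun x => ⟨v x, hvV x⟩
  have hsec := fun w => (hs (Φ w)).mpr ⟨w, rfl⟩
  have hsec' := fun w => (hs' (Φ' w)).mpr ⟨w, rfl⟩
  have hne : ∀ i x, x ∈ g.U i → Φ (e x) i x ≠ 0 := fun i x hx h => hv x (by
    have := hm (e x) (e x) i x hx
    rwa [h, mul_zero] at this)
  have hinner : ∀ (w w' : V) i l x, x ∈ g.U i → x ∈ g'.U l →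
      star (Φ w i x) * Φ w' i x = star (Φ' w l x) * Φ' w' l x := fun w w' i l x hi hl =>
    (hm w w' i x hi).symm.trans (hm' w w' l x hl)
  have hne' : ∀ (w : V) i l x, x ∈ g.U i → x ∈ g'.U l → Φ w i x ≠ 0 → Φ' w l x ≠ 0 := by
    intro w i l x hi hl h h'
    have := hinner w w i l x hi hl
    rw [h', mul_zero] at this
    exact (mul_ne_zero (star_ne_zero.mpr h) h) this
  have hnorm : ∀ (w : V) i l x, x ∈ g.U i → x ∈ g'.U l → Φ w i x ≠ 0 →
      ‖Φ w i x / Φ' w l x‖ = 1 := by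
    intro w i l x hi hl h
    have h' := hne' w i l x hi hl h
    have := congrArg norm (hinner w w i l x hi hl)
    rw [norm_mul, norm_mul, norm_star, norm_star, mul_self_inj (norm_nonneg _) (norm_nonneg _)]
      at this
    rw [norm_div, this, div_self (norm_ne_zero_iff.mpr h')]
  -- Both bundles compute the same inner products, which forces the ratio of the two coordinates to
  -- be the same for all sections that are non-zero at the point.
  have hratio : ∀ (w w' : V) i l x, x ∈ g.U i → x ∈ g'.U l → Φ w i x ≠ 0 → Φ w' i x ≠ 0 →
      Φ w i x / Φ' w l x = Φ w' i x / Φ' w' l x := by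
    intro w w' i l x hi hl h h'
    have k := hne' w i l x hi hl h
    have k' := hne' w' i l x hi hl h'
    have e1 := hinner w w i l x hi hl
    have e2 := hinner w w' i l x hi hl
    rw [div_eq_div_iff k k']
    refine mul_left_cancel₀ (mul_ne_zero (star_ne_zero.mpr h) (star_ne_zero.mpr k)) ?_
    linear_combination (star (Φ' w l x) * Φ' w' l x) * e1 - (star (Φ' w l x) * Φ' w l x) * e2
  let q : Fin g.n → Fin g'.n → T.Spec → ℂ := fun i l x => Φ (e x) i x / Φ' (e x) l x
  -- The value 1 is only a default: on `U i ∩ U' l` the quotient has modulus one by `hnorm`.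
  let c : Fin g.n → Fin g'.n → T.Spec → Circle := fun i l x =>
    if h : ‖q i l x‖ = 1 then ⟨q i l x, mem_sphere_zero_iff_norm.mpr h⟩ else 1
  have hc : ∀ i l x, x ∈ g.U i → x ∈ g'.U l → (c i l x : ℂ) = q i l x := by
    intro i l x hi hl
    exact congrArg Subtype.val (dif_pos (hnorm (e x) i l x hi hl (hne i x hi)))
  refine ⟨c, fun i l => ?_, fun i j l m x hx => ?_⟩
  · refine (Topology.IsInducing.mk rfl :
      Topology.IsInducing ((↑) : Circle → ℂ)).continuousOn_iff.mpr ?_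
    refine ContinuousOn.congr (f := q i l) (fun x hx => ?_) fun x hx => hc i l x hx.1 hx.2
    have h1 : ContinuousWithinAt (Φ (e x) i) (g.U i ∩ g'.U l) x :=
      ((hsec (e x)).1 i x hx.1).mono Set.inter_subset_left
    have h2 : ContinuousWithinAt (Φ' (e x) l) (g.U i ∩ g'.U l) x :=
      ((hsec' (e x)).1 l x hx.2).mono Set.inter_subset_right
    -- The section `e z` need not vary continuously with `z`. Near `x` it may be replaced by the
    -- fixed section `e x`, still non-zero there, without changing the ratio.
    refine (h1.div h2 (hne' _ i l x hx.1 hx.2 (hne i x hx.1))).congr_of_eventuallyEq ?_ rfl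
    filter_upwards [h1.eventually_ne (hne i x hx.1), self_mem_nhdsWithin] with z hz hzm
    exact hratio _ _ i l z hzm.1 hzm.2 (hne i z hzm.1) hz
  · obtain ⟨⟨hi, hj⟩, hl, hm⟩ := hx
    refine Subtype.ext ?_
    have h1 := (hsec (e x)).2.2 i j x ⟨hi, hj⟩
    have h2 := (hsec' (e x)).2.2 l m x ⟨hl, hm⟩
    have k1 := hne' (e x) i l x hi hl (hne i x hi)
    have k2 := hne' (e x) j m x hj hm (hne j x hj)
    change (g.g i j x * c j m x : ℂ) = c i l x * g'.g l m x
    rw [hc j m x hj hm, hc i l x hi hl]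
    simp only [q]
    rw [← mul_div_assoc, ← h1, div_mul_eq_mul_div, div_eq_div_iff k2 k1, h2]
    ring

namespace DualAtlas

variable {y : CechOneCocycle T.Spec (QGroup G)}

/-- The totally antisymmetric arrows are the sections of the determinant line bundle. -/
theorem isSectionModule (A : DualAtlas T G y)
    (hG : ∀ g ∈ G, (g : Matrix (Fin d) (Fin d) ℂ).det = 1) :
    T.IsSectionModule (T.antisymArrows d) (y.map (detQ G hG) (continuous_detQ G hG)) := by
  classical
  let Φ : T.antisymArrows d →ₗ[ℂ] (Fin y.n → T.Spec → ℂ) :=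
    { toFun := fun v i x => if h : x ∈ y.U i then A.coeff i ⟨x, h⟩ v else 0
      map_add' := fun v w => by
        ext i x
        by_cases h : x ∈ y.U i <;> simp [h]
      map_smul' := fun c v => by
        ext i x
        by_cases h : x ∈ y.U i <;> simp [h] }
  have hΦ : ∀ v i x (h : x ∈ y.U i), Φ v i x = A.coeff i ⟨x, h⟩ v := fun v i x h => dif_pos h
  have hΦ0 : ∀ v i x, x ∉ y.U i → Φ v i x = 0 := fun v i x h => dif_neg h
  have hfib : ∀ (v : T.antisymArrows d) i x (h : x ∈ y.U i),
      A.fibre i ⟨x, h⟩ v = Φ v i x • TMat.antisymTensor d := fun v i x h => by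
    rw [hΦ v i x h]
    exact A.mem_antisymArrows_iff.mp v.2 i ⟨x, h⟩
  have hΦ' : ∀ (v : T.antisymArrows d) i x (_ : x ∈ y.U i) (c : ℂ),
      A.fibre i ⟨x, ‹_›⟩ v = c • TMat.antisymTensor d → Φ v i x = c := fun v i x h c hc => by
    rw [hΦ v i x h]
    exact LocalChart.coeff_of_fibre_eq _ _ hc
  refine ⟨Φ, fun v w h => Subtype.ext (A.ext fun i x => ?_), fun s => ⟨fun hs => ?_, ?_⟩,
    fun f v w hw i x => ?_, fun v w i x hx => ?_⟩
  · rw [hfib v i x x.2, hfib w i x x.2]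
    exact congrArg (fun s : Fin y.n → T.Spec → ℂ => s i x • TMat.antisymTensor d) h
  -- Every section `s` comes from an arrow: glue `∑ h_i s_i v_i` from the local frames. In chart `j`
  -- the frame `v_i` acquires the phase `g_ji`, and `g_ji s_i = s_j`, so the coefficients sum to
  -- `s_j`.
  · obtain ⟨h, hh⟩ := PartitionOfUnity.exists_isSubordinate (isClosed_univ (X := T.Spec)) y.U
      y.isOpen (fun x _ => Set.mem_iUnion.mpr (y.cover x))
    choose f hf using fun i => exists_scalar_eq_mul y.isOpen hh i (hs.1 i)
    have hf0 : ∀ i, ∀ x ∉ y.U i, T.eval x (f i) = 0 := fun i x hx => by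
      rw [hf, hs.2.1 i x hx, mul_zero]
    choose v hv using A.exists_frame hG
    have hfr : ∀ j (x : y.U j), A.fibre j x (∑ i, T.scal (f i) (v i)) =
        s j x • TMat.antisymTensor d := by
      intro j x
      have h1 : ((∑ i, h i x : ℝ) : ℂ) = 1 := by
        rw [← finsum_eq_sum_of_fintype, h.sum_eq_one (Set.mem_univ _), Complex.ofReal_one]
      rw [map_sum, Finset.sum_congr rfl fun i _ => A.fibre_scal_frame hG (hv i) (hf0 i) j x,
        ← Finset.sum_smul, ← one_mul (s j x), ← h1, Complex.ofReal_sum, Finset.sum_mul]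
      congr 1
      refine Finset.sum_congr rfl fun i _ => ?_
      rw [hf]
      by_cases hx : (x : T.Spec) ∈ y.U i
      · have h2 : s j x = detQ G hG (y.g j i x) * s i x := hs.2.2 j i x ⟨x.2, hx⟩
        rw [h2]
        ring
      · have h0 : h i x = 0 := by
          by_contra h0
          exact hx (hh i (subset_tsupport _ h0))
        rw [h0, Complex.ofReal_zero, zero_mul, zero_mul, zero_mul]
    refine ⟨⟨_, A.mem_antisymArrows_of_fibre fun j x => ⟨_, hfr j x⟩⟩, ?_⟩
    ext j x
    by_cases hx : x ∈ y.U j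
    · exact hΦ' _ j x hx _ (hfr j ⟨x, hx⟩)
    · exact (hΦ0 _ j x hx).trans (hs.2.1 j x hx).symm
  · rintro ⟨v, rfl⟩
    refine ⟨fun i => ?_, fun i x hx => hΦ0 v i x hx, fun i j x hx => ?_⟩
    · rw [continuousOn_iff_continuous_domRestrict]
      have hc : Continuous fun x : y.U i => A.coeff i x v :=
        ((A.chart i).continuous_coeff v).comp (Continuous.subtype_mk continuous_subtype_val _)
      exact hc.congr fun x => (hΦ v i x x.2).symm
    · exact hΦ' v i x hx.1 _ (A.fibre_transition hG hx.1 hx.2 (hfib v j x hx.2))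
  · by_cases hx : x ∈ y.U i
    · refine hΦ' w i x hx _ ?_
      rw [hw, LocalChart.fibre_scal, mul_smul]
      congr 1
      exact hfib v i x hx
    · exact (hΦ0 w i x hx).trans ((congrArg _ (hΦ0 v i x hx)).trans (mul_zero _)).symm
  · exact LocalChart.eval_adj_comp _ ⟨x, A.subset i hx⟩ (hfib v i x hx) (hfib w i x hx)

end DualAtlas

end SymTensorCStarCat

theorem mainTheorem9 (T : SymTensorCStarCat.{u}) (F : SymTensorCStarCat.{v})
    (hT : T.IsSpecialCategory F) (d : ℕ) (hd : 1 ≤ d)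
    (G : Subgroup (Matrix.unitaryGroup (Fin d) ℂ))
    (hGclosed : IsClosed (G : Set (Matrix.unitaryGroup (Fin d) ℂ)))
    (hGdet : ∀ g ∈ G, (g : Matrix (Fin d) (Fin d) ℂ).det = 1)
    (q : HOne T.Spec (QGroup G)) (hq : T.IsAssociatedClass G q) :
    ∃ V : Submodule ℂ (T.Hom 0 d), T.IsTwistedSpecialObject d V ∧
      (∀ V' : Submodule ℂ (T.Hom 0 d), T.IsTwistedSpecialObject d V' → V' = V) ∧
      ∀ c : HTwoInt T.Spec, T.IsChernClass V c ↔
        c = connectingMap (HOne.map (detQ G hGdet) (continuous_detQ G hGdet) q) := by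
  obtain ⟨y, W, hU, π, rfl, -, htrans⟩ := hq
  let A : SymTensorCStarCat.DualAtlas T G y := ⟨W, hU, π, htrans⟩
  have hsec := A.isSectionModule hGdet
  refine ⟨T.antisymArrows d, A.isTwistedSpecialObject hd hGdet, fun V' hV' =>
    A.eq_antisymArrows hV', fun c => ⟨?_, ?_⟩⟩
  · rintro ⟨g, hg, rfl⟩
    -- The Parseval frame supplies, at each point, an antisymmetric arrow that is non-zero there, as
    -- needed to compare an arbitrary cocycle `g` with the determinant cocycle.
    obtain ⟨w, hw, -, hne⟩ := A.exists_parseval_frame hGdet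
    have h := SymTensorCStarCat.IsSectionModule.equivalent (fun x =>
      let ⟨i, hi⟩ := hne x
      ⟨w i, hw i, hi⟩) hg hsec
    exact congrArg connectingMap (Quotient.sound h)
  · rintro rfl
    exact ⟨_, hsec, rfl⟩
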